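/- \textbf{Calculus.} Let names $x,y,z,w,\dots$ (channel endpoints) range over a countably infinite set. Types are $A,B ::= A\otimes B \mid \mathbf 1 \mid A\parr B \mid \bot \mid A\oplus B \mid \mathbf 0 \mid A\mathbin{\&}B \mid \top \mid {!_n}A \mid {?_n}A$ with $n\in\mathbb N$; duality is given by $(A\otimes B)^\bot=A^\bot\parr B^\bot$, $\mathbf 1^\bot=\bot$, $(A\oplus B)^\bot=A^\bot\mathbin{\&}B^\bot$, $\mathbf 0^\bot=\top$, $({!_n}A)^\bot={?_n}A^\bot$, and symmetrically. Processes are $$P,Q,R ::= x{\leftrightarrow}y \mid 0 \mid (\nu xx')P \mid (P\mid Q) \mid x[y].P \mid x(y).P \mid x[].P \mid x().P \mid x\triangleleft\mathrm{inl}.P \mid x\triangleleft\mathrm{inr}.P \mid x\triangleright\{\mathrm{inl}:P;\mathrm{inr}:Q\} \mid x\triangleright\{\} \mid \star x[y].P \mid \star x(y).P,$$ where $(\nu xx')P$ (a cut) binds $x,x'$ in $P$, and $x[y].P$, $x(y).P$, $\star x[y].P$, $\star x(y).P$ bind $y$ in $P$; $(P\mid Q)$ is a mix. Processes are taken up to $\alpha$-equivalence;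 $P\{w/x\}$ is capture-avoiding substitution of $w$ for $x$; bound names are assumed to be chosen distinct from all other names where needed. \textbf{Structural congruence} $\equiv$ is the least congruence with $x{\leftrightarrow}y\equiv y{\leftrightarrow}x$; $P\mid Q\equiv Q\mid P$; $P\mid(Q\mid R)\equiv(P\mid Q)\mid R$; $P\mid 0\equiv P$; $(\nu xx')0\equiv 0$; $(\nu xx')P\equiv(\nu x'x)P$; $(\nu xx')(\nu yy')P\equiv(\nu yy')(\nu xx')P$; $(\nu xx')(P\mid Q)\equiv P\mid(\nu xx')Q$ if $x,x'$ are not free in $P$. \textbf{Typing.} An environment $\Gamma$ is a finite multiset of declarations $x:A$, and a hyper-environment $\mathcal G=\Gamma_1\parallel\dots\parallel\Gamma_n$ is a finite multiset of environments ($\varnothing$ is the empty one). In every judgement $P\vdash\mathcal G$ all names declared in $\mathcal G$ are distinct. The rules are: \begin{itemize} \item $x{\leftrightarrow}y\vdash x:A,\,y:A^\bot$; $\quad 0\vdash\varnothing$; $\quad x\triangleright\{\}\vdash\Gamma,x:\top$; \item if $P\vdash\mathcal G\parallel\Gamma,x:A\parallel\Delta,x':A^\bot$ then $(\nu xx')P\vdash\mathcal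 G\parallel\Gamma,\Delta$; $\quad$ if $P\vdash\mathcal G$ and $Q\vdash\mathcal H$ then $P\mid Q\vdash\mathcal G\parallel\mathcal H$; \item if $P\vdash\Gamma,y:A\parallel\Delta,x:B$ then $x[y].P\vdash\Gamma,\Delta,x:A\otimes B$; $\quad$ if $P\vdash\Gamma,y:A,x:B$ then $x(y).P\vdash\Gamma,x:A\parr B$; \item if $P\vdash\varnothing$ then $x[].P\vdash x:\mathbf 1$; $\quad$ if $P\vdash\Gamma$ then $x().P\vdash\Gamma,x:\bot$; \item if $P\vdash\Gamma,x:A$ then $x\triangleleft\mathrm{inl}.P\vdash\Gamma,x:A\oplus B$; $\quad$ if $P\vdash\Gamma,x:B$ then $x\triangleleft\mathrm{inr}.P\vdash\Gamma,x:A\oplus B$; $\quad$ if $P\vdash\Gamma,x:A$ and $Q\vdash\Gamma,x:B$ then $x\triangleright\{\mathrm{inl}:P;\mathrm{inr}:Q\}\vdash\Gamma,x:A\mathbin{\&}B$; \item if $P\vdash\Gamma,y:A$ then $\star x[y].P\vdash\Gamma,x:{!_1}A$ and $\star x(y).P\vdash\Gamma,x:{?_1}A$; \item if $P\vdash\mathcal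 G\parallel\Gamma,x:{!_m}A\parallel\Delta,x':{!_n}A$ then $P\{x/x'\}\vdash\mathcal G\parallel\Gamma,\Delta,x:{!_{m+n}}A$; $\quad$ if $P\vdash\mathcal G\parallel\Gamma,x:{?_m}A,x':{?_n}A$ then $P\{x/x'\}\vdash\mathcal G\parallel\Gamma,x:{?_{m+n}}A$. \end{itemize} \textbf{Reduction} $\Longrightarrow$ is the least relation with \begin{align*} (\nu xx')(w{\leftrightarrow}x\mid P)&\Longrightarrow P\{w/x'\},\\ (\nu xx')(x[y].P\mid x'(y').R)&\Longrightarrow(\nu xx')(\nu yy')(P\mid R),\\ (\nu xx')(x[].P\mid x'().Q)&\Longrightarrow P\mid Q,\\ (\nu xx')(x\triangleleft\mathrm{inl}.P\mid x'\triangleright\{\mathrm{inl}:Q;\mathrm{inr}:R\})&\Longrightarrow(\nu xx')(P\mid Q),\\ (\nu xx')(x\triangleleft\mathrm{inr}.P\mid x'\triangleright\{\mathrm{inl}:Q;\mathrm{inr}:R\})&\Longrightarrow(\nu xx')(P\mid R),\\ (\nu xx')((\star x[y].P\mid\star x'(y').Q)\mid R)&\Longrightarrow(\nu xx')((\nu yy')(P\mid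 Q)\mid R), \end{align*} closed under $(\nu xx')[\cdot]$, under $[\cdot]\mid Q$, and under $\equiv$ on both sides. \textbf{Canonical forms.} A process acts on the names that are free in its outermost term constructor (a link $x{\leftrightarrow}y$ acts on $x$ and $y$; $0$, cuts and mixes act on none; any other process acts only on its subject). A process $P$ is in canonical form if $P\equiv(\nu x_1x_1')\cdots(\nu x_nx_n')(P_1\mid\dots\mid P_{n+m+1})$ for some $n,m\ge 0$, with distinct bound endpoints $x_1,x_1',\dots,x_n,x_n'$, such that no $P_i$ is a cut or a mix, no $P_i$ is a link acting on a bound endpoint $x_k$ or $x_k'$, and no two processes $P_i,P_j$ with $i\ne j$ act on dual endpoints $x_k$ and $x_k'$ of the same channel, respectively. \textbf{Theorem (Progress).} Let $P\vdash\mathcal G$. Then $P$ is in canonical form, or there is a process $Q$ with $P\Longrightarrow Q$. Moreover, if $\mathcal G\neq\varnothing$ is not the empty hyper-environment and $P$ is in canonical form, then in every congruent term $(\nu x_1x_1')\cdots(\nu x_nx_n')(P_1\mid\dots\mid P_{n+m+1})$ that witnesses this, at least one $P_i$ acts on a free name, that is, on a name that is not among $x_1,x_1',\dots,x_n,x_n'$.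 -/

import Mathlib

namespace NodCap

/-! ### Types and duality -/

/-- Session types: the multiplicative-additive connectives with their units, together with
`bang n A` (written `!ₙ A`, a pool of `n` clients) and `quest n A` (written `?ₙ A`,
`n` server interactions). -/
inductive Ty : Type
  | tensor (A B : Ty)
  | one
  | parr (A B : Ty)
  | bot
  | plus (A B : Ty)
  | zero
  | amp (A B : Ty)
  | top
  | bang (n : ℕ) (A : Ty)
  | quest (n : ℕ) (A : Ty)

/-- Duality `A^⊥`. -/
def Ty.dual : Ty → Ty
  | .tensor A B => .parr A.dual B.dual
  | .one => .bot
  | .parr A B => .tensor A.dual B.dual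
  | .bot => .one
  | .plus A B => .amp A.dual B.dual
  | .zero => .top
  | .amp A B => .plus A.dual B.dual
  | .top => .zero
  | .bang n A => .quest n A.dual
  | .quest n A => .bang n A.dual

/-! ### Terms, free names, substitution -/

/-- Names of channel endpoints: a countably infinite set. -/
abbrev Name : Type := ℕ

/-- Raw terms. The binders are `new x x' P` (binds `x`, `x'` in `P`) and `send x y P`,
`recv x y P`, `client x y P`, `server x y P` (each binds `y` in `P`). -/
inductive Proc : Type
  /-- `x ↔ y`, link -/
  | link (x y : Name)
  /-- `0`, terminated process -/
  | halt
  /-- `(ν x x') P`, name restriction (cut) -/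
  | new (x x' : Name) (P : Proc)
  /-- `P | Q`, parallel composition (mix) -/
  | par (P Q : Proc)
  /-- `x[y].P`, output -/
  | send (x y : Name) (P : Proc)
  /-- `x(y).P`, input -/
  | recv (x y : Name) (P : Proc)
  /-- `x[].P`, halt -/
  | close (x : Name) (P : Proc)
  /-- `x().P`, wait -/
  | wait (x : Name) (P : Proc)
  /-- `x ◁ inl. P`, select left -/
  | inl (x : Name) (P : Proc)
  /-- `x ◁ inr. P`, select right -/
  | inr (x : Name) (P : Proc)
  /-- `x ▷ {inl: P; inr: Q}`, offer binary choice -/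
  | offer (x : Name) (P Q : Proc)
  /-- `x ▷ {}`, offer nullary choice -/
  | offerNone (x : Name)
  /-- `★x[y].P`, client creation -/
  | client (x y : Name) (P : Proc)
  /-- `★x(y).P`, server interaction -/
  | server (x y : Name) (P : Proc)

/-- Free names. -/
def Proc.fn : Proc → Finset Name
  | .link x y => {x, y}
  | .halt => ∅
  | .new x x' P => (P.fn.erase x).erase x'
  | .par P Q => P.fn ∪ Q.fn
  | .send x y P => insert x (P.fn.erase y)
  | .recv x y P => insert x (P.fn.erase y)
  | .close x P => insert x P.fn
  | .wait x P => insert x P.fn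
  | .inl x P => insert x P.fn
  | .inr x P => insert x P.fn
  | .offer x P Q => insert x (P.fn ∪ Q.fn)
  | .offerNone x => {x}
  | .client x y P => insert x (P.fn.erase y)
  | .server x y P => insert x (P.fn.erase y)

/-- A name outside a given finite set. -/
def fresh (s : Finset Name) : Name := s.sup id + 1

theorem fresh_not_mem (s : Finset Name) : fresh s ∉ s := by
  intro h
  have h1 : id (fresh s) ≤ s.sup id := Finset.le_sup h
  exact absurd h1 (Nat.not_succ_le_self _)

/-- Simultaneous capture-avoiding renaming of the free names of a term: every bound name is
replaced by one that differs from the images of all free names in its scope. -/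
def Proc.rename : Proc → (Name → Name) → Proc
  | .link x y, σ => .link (σ x) (σ y)
  | .halt, _ => .halt
  | .new x x' P, σ =>
      let s := ((P.fn.erase x).erase x').image σ
      let z := fresh s
      let z' := fresh (insert z s)
      .new z z' (P.rename (Function.update (Function.update σ x z) x' z'))
  | .par P Q, σ => .par (P.rename σ) (Q.rename σ)
  | .send x y P, σ =>
      let z := fresh ((P.fn.erase y).image σ)
      .send (σ x) z (P.rename (Function.update σ y z))
  | .recv x y P, σ =>
      let z := fresh ((P.fn.erase y).image σ)
      .recv (σ x) z (P.rename (Function.update σ y z))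
  | .close x P, σ => .close (σ x) (P.rename σ)
  | .wait x P, σ => .wait (σ x) (P.rename σ)
  | .inl x P, σ => .inl (σ x) (P.rename σ)
  | .inr x P, σ => .inr (σ x) (P.rename σ)
  | .offer x P Q, σ => .offer (σ x) (P.rename σ) (Q.rename σ)
  | .offerNone x, σ => .offerNone (σ x)
  | .client x y P, σ =>
      let z := fresh ((P.fn.erase y).image σ)
      .client (σ x) z (P.rename (Function.update σ y z))
  | .server x y P, σ =>
      let z := fresh ((P.fn.erase y).image σ)
      .server (σ x) z (P.rename (Function.update σ y z))

/-- `P.subst w x` is `P{w/x}`: the free occurrences of `x` are replaced by `w`. -/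
def Proc.subst (P : Proc) (w x : Name) : Proc := P.rename (Function.update id x w)

/-! ### Congruences -/

/-- The least congruence (an equivalence relation compatible with every term constructor) that
contains the relation `R`. -/
inductive CongClosure (R : Proc → Proc → Prop) : Proc → Proc → Prop
  | ax {P Q} : R P Q → CongClosure R P Q
  | refl (P) : CongClosure R P P
  | symm {P Q} : CongClosure R P Q → CongClosure R Q P
  | trans {P Q S} : CongClosure R P Q → CongClosure R Q S → CongClosure R P S
  | new (x x') {P P'} : CongClosure R P P' → CongClosure R (.new x x' P) (.new x x' P')
  | par {P P' Q Q'} : CongClosure R P P' → CongClosure R Q Q' →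
      CongClosure R (.par P Q) (.par P' Q')
  | send (x y) {P P'} : CongClosure R P P' → CongClosure R (.send x y P) (.send x y P')
  | recv (x y) {P P'} : CongClosure R P P' → CongClosure R (.recv x y P) (.recv x y P')
  | close (x) {P P'} : CongClosure R P P' → CongClosure R (.close x P) (.close x P')
  | wait (x) {P P'} : CongClosure R P P' → CongClosure R (.wait x P) (.wait x P')
  | inl (x) {P P'} : CongClosure R P P' → CongClosure R (.inl x P) (.inl x P')
  | inr (x) {P P'} : CongClosure R P P' → CongClosure R (.inr x P) (.inr x P')
  | offer (x) {P P' Q Q'} : CongClosure R P P' → CongClosure R Q Q' →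
      CongClosure R (.offer x P Q) (.offer x P' Q')
  | client (x y) {P P'} : CongClosure R P P' → CongClosure R (.client x y P) (.client x y P')
  | server (x y) {P P'} : CongClosure R P P' → CongClosure R (.server x y P) (.server x y P')

/-- Renaming of one bound name (of the two bound names, for `new`) to fresh ones. -/
inductive AlphaAx : Proc → Proc → Prop
  | new (x x' z z' P) : z ≠ z' → z ∉ (Proc.new x x' P).fn → z' ∉ (Proc.new x x' P).fn →
      AlphaAx (.new x x' P)
        (.new z z' (P.rename (Function.update (Function.update id x z) x' z')))
  | send (x y z P) : z ∉ P.fn.erase y → AlphaAx (.send x y P) (.send x z (P.subst z y))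
  | recv (x y z P) : z ∉ P.fn.erase y → AlphaAx (.recv x y P) (.recv x z (P.subst z y))
  | client (x y z P) : z ∉ P.fn.erase y → AlphaAx (.client x y P) (.client x z (P.subst z y))
  | server (x y z P) : z ∉ P.fn.erase y → AlphaAx (.server x y P) (.server x z (P.subst z y))

/-- α-equivalence. -/
def Alpha : Proc → Proc → Prop := CongClosure AlphaAx

/-- The axioms of structural congruence. By `newSwap`, a restriction joins two endpoints
without distinguishing an order between them. -/
inductive StructAx : Proc → Proc → Prop
  | alpha {P Q} : AlphaAx P Q → StructAx P Q
  | linkComm (x y) : StructAx (.link x y) (.link y x)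
  | mixComm (P Q) : StructAx (.par P Q) (.par Q P)
  | mixAssoc (P Q R) : StructAx (.par P (.par Q R)) (.par (.par P Q) R)
  | mixHalt (P) : StructAx (.par P .halt) P
  | newHalt (x x') : StructAx (.new x x' .halt) .halt
  | newSwap (x x' P) : StructAx (.new x x' P) (.new x' x P)
  | newComm (x x' y y' P) : x ≠ y → x ≠ y' → x' ≠ y → x' ≠ y' →
      StructAx (.new x x' (.new y y' P)) (.new y y' (.new x x' P))
  | scopeExt (x x' P Q) : x ∉ P.fn → x' ∉ P.fn →
      StructAx (.new x x' (.par P Q)) (.par P (.new x x' Q))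

/-- Structural congruence `P ≡ Q`. -/
def StructEq : Proc → Proc → Prop := CongClosure StructAx

/-! ### Typing -/

/-- Environments `x₁ : A₁, …, xₙ : Aₙ`. `Γ, Δ` is `Γ + Δ`, and `Γ, x : A` is `(x, A) ::ₘ Γ`. -/
abbrev Env : Type := Multiset (Name × Ty)

/-- Hyper-environments: multisets of environments. `𝒢 ∣ ℋ` is `𝒢 + ℋ`, and `𝒢 ∣ Γ` is
`Γ ::ₘ 𝒢`. -/
abbrev HyperEnv : Type := Multiset Env

/-- All the names that are declared in a hyper-environment are distinct. -/
def HyperEnv.Distinct (G : HyperEnv) : Prop := (G.join.map Prod.fst).Nodup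

/-- `Typed P G` is the typing judgement `P ⊢ G`. Terms are taken up to α-equivalence (`alpha`).
The side conditions say that the names declared in the conclusion are distinct; for the rules
without such a condition this follows from the distinctness in the premise. -/
inductive Typed : Proc → HyperEnv → Prop
  | alpha {P Q G} : Alpha P Q → Typed P G → Typed Q G
  -- structural rules
  | ax (x y A) : x ≠ y → Typed (.link x y) {(x, A) ::ₘ {(y, Ty.dual A)}}
  | cut (x x' A) {P Γ Δ G} :
      Typed P (((x, A) ::ₘ Γ) ::ₘ ((x', Ty.dual A) ::ₘ Δ) ::ₘ G) →
      Typed (.new x x' P) ((Γ + Δ) ::ₘ G)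
  | mix {P Q G H} : HyperEnv.Distinct (G + H) → Typed P G → Typed Q H →
      Typed (.par P Q) (G + H)
  | halt : Typed .halt 0
  -- logical rules
  | tensor (x y A B) {P Γ Δ} :
      Typed P (((y, A) ::ₘ Γ) ::ₘ {(x, B) ::ₘ Δ}) →
      Typed (.send x y P) {(x, Ty.tensor A B) ::ₘ (Γ + Δ)}
  | parr (x y A B) {P Γ} :
      Typed P {(y, A) ::ₘ (x, B) ::ₘ Γ} →
      Typed (.recv x y P) {(x, Ty.parr A B) ::ₘ Γ}
  | one (x) {P} : Typed P 0 → Typed (.close x P) {{(x, Ty.one)}}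
  | bot (x) {P Γ} : HyperEnv.Distinct {(x, Ty.bot) ::ₘ Γ} → Typed P {Γ} →
      Typed (.wait x P) {(x, Ty.bot) ::ₘ Γ}
  | plusLeft (x A B) {P Γ} : Typed P {(x, A) ::ₘ Γ} →
      Typed (.inl x P) {(x, Ty.plus A B) ::ₘ Γ}
  | plusRight (x A B) {P Γ} : Typed P {(x, B) ::ₘ Γ} →
      Typed (.inr x P) {(x, Ty.plus A B) ::ₘ Γ}
  | amp (x A B) {P Q Γ} : Typed P {(x, A) ::ₘ Γ} → Typed Q {(x, B) ::ₘ Γ} →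
      Typed (.offer x P Q) {(x, Ty.amp A B) ::ₘ Γ}
  | top (x) (Γ : Env) : HyperEnv.Distinct {(x, Ty.top) ::ₘ Γ} →
      Typed (.offerNone x) {(x, Ty.top) ::ₘ Γ}
  -- clients and servers
  | bangOne (x y A) {P Γ} : HyperEnv.Distinct {(x, Ty.bang 1 A) ::ₘ Γ} →
      Typed P {(y, A) ::ₘ Γ} → Typed (.client x y P) {(x, Ty.bang 1 A) ::ₘ Γ}
  | questOne (x y A) {P Γ} : HyperEnv.Distinct {(x, Ty.quest 1 A) ::ₘ Γ} →
      Typed P {(y, A) ::ₘ Γ} → Typed (.server x y P) {(x, Ty.quest 1 A) ::ₘ Γ}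
  | contBang (x x' m n A) {P Γ Δ G} :
      Typed P (((x, Ty.bang m A) ::ₘ Γ) ::ₘ ((x', Ty.bang n A) ::ₘ Δ) ::ₘ G) →
      Typed (P.subst x x') (((x, Ty.bang (m + n) A) ::ₘ (Γ + Δ)) ::ₘ G)
  | contQuest (x x' m n A) {P Γ G} :
      Typed P (((x, Ty.quest m A) ::ₘ (x', Ty.quest n A) ::ₘ Γ) ::ₘ G) →
      Typed (P.subst x x') (((x, Ty.quest (m + n) A) ::ₘ Γ) ::ₘ G)

/-! ### Reduction -/

/-- Reduction `P ⟹ Q`. The side conditions on `y` and `y'` say that the two bound names are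
distinct and fresh for the other process, so that `(ν y y')` captures nothing. -/
inductive Red : Proc → Proc → Prop
  | link (w x x' P) : Red (.new x x' (.par (.link w x) P)) (P.subst w x')
  | tensorParr (x x' y y' P R) : y ≠ y' → y ∉ R.fn → y' ∉ P.fn →
      Red (.new x x' (.par (.send x y P) (.recv x' y' R)))
        (.new x x' (.new y y' (.par P R)))
  | oneBot (x x' P Q) : Red (.new x x' (.par (.close x P) (.wait x' Q))) (.par P Q)
  | plusAmpLeft (x x' P Q R) :
      Red (.new x x' (.par (.inl x P) (.offer x' Q R))) (.new x x' (.par P Q))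
  | plusAmpRight (x x' P Q R) :
      Red (.new x x' (.par (.inr x P) (.offer x' Q R))) (.new x x' (.par P R))
  | star (x x' y y' P Q R) : y ≠ y' → y ∉ Q.fn → y' ∉ P.fn →
      Red (.new x x' (.par (.par (.client x y P) (.server x' y' Q)) R))
        (.new x x' (.par (.new y y' (.par P Q)) R))
  | new (x x') {P P'} : Red P P' → Red (.new x x' P) (.new x x' P')
  | mix (Q) {P P'} : Red P P' → Red (.par P Q) (.par P' Q)
  | equiv {P Q Q' P'} : StructEq P Q → Red Q Q' → StructEq Q' P' → Red P P'

/-! ### Canonical forms -/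

/-- The names on which a process acts: those that are free in its outermost term constructor. -/
def Proc.actsOn : Proc → Set Name
  | .link x y => {x, y}
  | .halt => ∅
  | .new _ _ _ => ∅
  | .par _ _ => ∅
  | .send x _ _ => {x}
  | .recv x _ _ => {x}
  | .close x _ => {x}
  | .wait x _ => {x}
  | .inl x _ => {x}
  | .inr x _ => {x}
  | .offer x _ _ => {x}
  | .offerNone x => {x}
  | .client x _ _ => {x}
  | .server x _ _ => {x}

/-- `(ν x₁ x₁') … (ν xₙ xₙ') P`. -/
def news : List (Name × Name) → Proc → Proc
  | [], P => P
  | c :: cs, P => .new c.1 c.2 (news cs P)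

/-- `P₁ | (P₂ | … | Pₖ)`; only used for `k ≥ 1`. -/
def pars : List Proc → Proc
  | [] => .halt
  | [P] => P
  | P :: Q :: Ps => .par P (pars (Q :: Ps))

/-- The list `x₁, x₁', …, xₙ, xₙ'` of all the endpoints of the given channels. -/
def endpoints (cs : List (Name × Name)) : List Name := cs.flatMap fun c => [c.1, c.2]

/-- `IsCanonicalFormOf cs Ps P`: the process `P` is structurally congruent to
`(ν x₁ x₁') … (ν xₙ xₙ') (P₁ | … | Pₙ₊ₘ₊₁)`, where the list `cs` holds the channels and `Ps`
the processes, and this is a canonical form. -/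
structure IsCanonicalFormOf (cs : List (Name × Name)) (Ps : List Proc) (P : Proc) : Prop where
  equiv : StructEq P (news cs (pars Ps))
  /-- the bound endpoints are distinct names -/
  nodup : (endpoints cs).Nodup
  /-- there are `n + m + 1` processes for some `m ≥ 0` -/
  length : ∃ m, Ps.length = cs.length + m + 1
  /-- no `Pᵢ` is a cut -/
  not_new : ∀ R ∈ Ps, ∀ x x' Q, R ≠ Proc.new x x' Q
  /-- no `Pᵢ` is a mix -/
  not_par : ∀ R ∈ Ps, ∀ Q Q', R ≠ Proc.par Q Q'
  /-- no `Pᵢ` is a link that acts on a bound endpoint -/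
  not_link : ∀ u v, Proc.link u v ∈ Ps → u ∉ endpoints cs ∧ v ∉ endpoints cs
  /-- no two processes act on dual endpoints of the same channel -/
  not_dual : ∀ c ∈ cs, ∀ i j : Fin Ps.length, i ≠ j →
    ¬ (c.1 ∈ (Ps.get i).actsOn ∧ c.2 ∈ (Ps.get j).actsOn)

/-- The process `P` is in canonical form. -/
def IsCanonical (P : Proc) : Prop := ∃ cs Ps, IsCanonicalFormOf cs Ps P

end NodCap

namespace NodCap

/-! ### Top-level occurrences of a name -/

/-! Progress does not need typing to be stable under structural congruence. Two facts are extracted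
from a typing derivation and expressed as conditions on top-level cuts that are themselves invariant
under `≡`. For a name `x`, `Proc.occ x` is the multiset of top-level components in which `x` is
free, each marked with its head if it acts on `x`. `AllCuts C` imposes a relation `C` on the
occurrences of the two endpoints of every top-level cut. Occurrences are invariant under `≡`, and so
is `AllCuts C` once `C` is symmetric and holds for unused endpoints (`StructEq.occ_eq`,
`StructEq.allCuts_iff`).

For the first half, take `C = Matched`: the endpoints are used according to dual types, and by at
most one component each unless the type is `!` or `?`. Typing gives this (`Typed.respects`,
`Typed.allCuts_matched`), and it transfers to a normal form, that is, cuts with distinct endpoints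
around a mix of prime processes (`exists_structEq_news`). A link on a bound endpoint reduces at
once. Two non-link components acting on dual endpoints have dual heads, hence form a redex
(`reduces_of_matched`): at a linear type no third component uses the channel, so the others leave
the scope of the cut, while at an exponential type the reduction rule tolerates them. If neither
situation occurs, the normal form is canonical (`canonical_or_reduces`).

For the second half, take `C = Silent`. A canonical form is silent, hence so is the original process
(`IsCanonicalFormOf.silent`). Induction on its typing then finds an acting name in every environment
(`Typed.exists_acting`): a cut could lose all acting names of the merged environment only if both
premises acted exactly on the two endpoints, which silence forbids. A name with occurrences in the
whole process is not bound by the outer cuts. -/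

/-- The outermost constructors of the processes that are neither cuts, mixes nor `0`. -/
inductive Head : Type
  | link | send | recv | close | wait | inl | inr | offer | offerNone | client | server

/-- The contribution of a component with head `h`, subject `y` and other free names `s` to the
occurrences of `x`. -/
def headOcc (h : Head) (y : Name) (s : Finset Name) (x : Name) : Multiset (Option Head) :=
  if x = y then {some h} else if x ∈ s then {none} else 0

/-- The top-level components of a process in which `x` is free; a component that acts on `x` is
recorded with its head, the others as `none`. -/
def Proc.occ (x : Name) : Proc → Multiset (Option Head)
  | .link y z => if x = y ∨ x = z then {some .link} else 0
  | .halt => 0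
  | .new y y' P => if x = y ∨ x = y' then 0 else P.occ x
  | .par P Q => P.occ x + Q.occ x
  | .send y z P => headOcc .send y (P.fn.erase z) x
  | .recv y z P => headOcc .recv y (P.fn.erase z) x
  | .close y P => headOcc .close y P.fn x
  | .wait y P => headOcc .wait y P.fn x
  | .inl y P => headOcc .inl y P.fn x
  | .inr y P => headOcc .inr y P.fn x
  | .offer y P Q => headOcc .offer y (P.fn ∪ Q.fn) x
  | .offerNone y => headOcc .offerNone y ∅ x
  | .client y z P => headOcc .client y (P.fn.erase z) x
  | .server y z P => headOcc .server y (P.fn.erase z) x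

/-- Every top-level cut satisfies the condition `C` on the occurrences of its two endpoints. -/
def Proc.AllCuts (C : Multiset (Option Head) → Multiset (Option Head) → Prop) : Proc → Prop
  -- Raw terms allow `x = x'`. The α-axiom updates at `x` first and at `x'` second, so the second
  -- update wins and the first endpoint must count as unused.
  | .new x x' P => P.AllCuts C ∧ C (if x = x' then 0 else P.occ x) (P.occ x')
  | .par P Q => P.AllCuts C ∧ Q.AllCuts C
  | _ => True

theorem headOcc_eq_zero {h : Head} {y : Name} {s : Finset Name} {x : Name} :
    headOcc h y s x = 0 ↔ x ∉ insert y s := by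
  unfold headOcc
  split_ifs <;> simp_all

theorem occ_eq_zero {x : Name} {P : Proc} : P.occ x = 0 ↔ x ∉ P.fn := by
  induction P with
  | link y z => simp only [Proc.occ, Proc.fn]; split_ifs <;> simp_all
  | halt => simp [Proc.occ, Proc.fn]
  | new y y' P ih =>
    simp only [Proc.occ, Proc.fn, Finset.mem_erase]
    split_ifs with e
    · simp only [true_iff]; tauto
    · rw [ih]; tauto
  | par P Q ihP ihQ => simp [Proc.occ, Proc.fn, ihP, ihQ]
  | _ => simp only [Proc.occ, Proc.fn, headOcc_eq_zero, insert_empty_eq]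

/-! ### Free names, occurrences and cuts under renaming -/

theorem image_update_erase (s : Finset Name) (σ : Name → Name) {y z : Name}
    (hz : z ∉ (s.erase y).image σ) :
    (s.image (Function.update σ y z)).erase z = (s.erase y).image σ := by
  ext a
  simp only [Finset.mem_erase, Finset.mem_image, Function.update_apply] at hz ⊢
  constructor
  · rintro ⟨ha, b, hb, rfl⟩
    by_cases h : b = y
    · simp [h] at ha
    · exact ⟨b, ⟨h, hb⟩, by simp [h]⟩
  · rintro ⟨b, ⟨h, hb⟩, rfl⟩
    exact ⟨fun h' => hz ⟨b, ⟨h, hb⟩, h'⟩, b, hb, by simp [h]⟩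

theorem image_update_update_erase (s : Finset Name) (σ : Name → Name) {x x' z z' : Name}
    (hz : z ∉ ((s.erase x).erase x').image σ) (hz' : z' ∉ ((s.erase x).erase x').image σ) :
    ((s.image (Function.update (Function.update σ x z) x' z')).erase z).erase z' =
      ((s.erase x).erase x').image σ := by
  ext a
  simp only [Finset.mem_erase, Finset.mem_image, Function.update_apply] at hz hz' ⊢
  constructor
  · rintro ⟨ha', ha, b, hb, rfl⟩
    by_cases h' : b = x'
    · simp [h'] at ha'
    · by_cases h : b = x
      · subst h; simp [h'] at ha
      · exact ⟨b, ⟨h', h, hb⟩, by simp [h, h']⟩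
  · rintro ⟨b, ⟨h', h, hb⟩, rfl⟩
    exact ⟨fun e => hz' ⟨b, ⟨h', h, hb⟩, e⟩, fun e => hz ⟨b, ⟨h', h, hb⟩, e⟩, b, hb,
      by simp [h, h']⟩

theorem fresh_fresh_ne (s : Finset Name) : fresh s ≠ fresh (insert (fresh s) s) := fun h =>
  fresh_not_mem (insert (fresh s) s) (h ▸ Finset.mem_insert_self _ _)

theorem fresh_insert_not_mem (a : Name) (s : Finset Name) : fresh (insert a s) ∉ s := fun h =>
  fresh_not_mem (insert a s) (Finset.mem_insert_of_mem h)

theorem fn_rename (P : Proc) (σ : Name → Name) : (P.rename σ).fn = P.fn.image σ := by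
  induction P generalizing σ with
  | link y z => simp [Proc.rename, Proc.fn]
  | halt => simp [Proc.rename, Proc.fn]
  | new y y' P ih =>
    simp only [Proc.rename, Proc.fn, ih]
    exact image_update_update_erase _ _ (fresh_not_mem _) (fresh_insert_not_mem _ _)
  | par P Q ihP ihQ => simp [Proc.rename, Proc.fn, ihP, ihQ, Finset.image_union]
  | send y z P ih | recv y z P ih | client y z P ih | server y z P ih =>
    simp only [Proc.rename, Proc.fn, ih, Finset.image_insert]
    rw [image_update_erase _ _ (fresh_not_mem _)]
  | close y P ih | wait y P ih | inl y P ih | inr y P ih =>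
    simp only [Proc.rename, Proc.fn, ih, Finset.image_insert]
  | offer y P Q ihP ihQ =>
    simp only [Proc.rename, Proc.fn, ihP, ihQ, Finset.image_insert, Finset.image_union]
  | offerNone y => simp [Proc.rename, Proc.fn]

theorem headOcc_image {h : Head} {y : Name} {s : Finset Name} {σ : Name → Name} {a c : Name}
    (H : ∀ b ∈ insert y s, σ b = a ↔ b = c) :
    headOcc h (σ y) (s.image σ) a = headOcc h y s c := by
  have hy : a = σ y ↔ c = y := by
    rw [eq_comm, H y (Finset.mem_insert_self _ _), eq_comm]
  have hs : a ∈ s.image σ ↔ c ∈ s := by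
    simp only [Finset.mem_image]
    constructor
    · rintro ⟨b, hb, e⟩
      rwa [← (H b (Finset.mem_insert_of_mem hb)).1 e]
    · intro hc
      exact ⟨c, hc, (H c (Finset.mem_insert_of_mem hc)).2 rfl⟩
  simp only [headOcc, hy, hs]

/-- Renaming the two names bound by a cut, together with its free names. -/
theorem occ_new_update {x x' z z' : Name} {P : Proc} {σ : Name → Name} {a c : Name}
    (hz : z ∉ ((P.fn.erase x).erase x').image σ) (hz' : z' ∉ ((P.fn.erase x).erase x').image σ)
    (ih : ∀ (σ : Name → Name) {a c : Name}, (∀ b ∈ P.fn, σ b = a ↔ b = c) →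
      (P.rename σ).occ a = P.occ c)
    (H : ∀ b ∈ (Proc.new x x' P).fn, σ b = a ↔ b = c) :
    (Proc.new z z' (P.rename (Function.update (Function.update σ x z) x' z'))).occ a =
      (Proc.new x x' P).occ c := by
  -- Bound names make both sides vanish: if `a` is a new binder, freshness shows that `c` is not
  -- free; if `c` is an old binder, no free name of the cut is sent to `a`.
  by_cases ha : a = z ∨ a = z'
  · have h0 : (Proc.new x x' P).occ c = 0 := by
      rw [occ_eq_zero]
      intro hc
      have hi : a ∈ ((P.fn.erase x).erase x').image σ :=
        Finset.mem_image.2 ⟨c, hc, (H c hc).2 rfl⟩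
      rcases ha with rfl | rfl
      exacts [hz hi, hz' hi]
    rw [h0]
    simp [Proc.occ, ha]
  · by_cases hc : c = x ∨ c = x'
    · have h0 : (Proc.new x x' P).occ c = 0 := by simp [Proc.occ, hc]
      rw [h0, occ_eq_zero]
      simp only [Proc.fn, fn_rename]
      rw [image_update_update_erase _ _ hz hz']
      intro hi
      obtain ⟨b, hb, e⟩ := Finset.mem_image.1 hi
      have := (H b hb).1 e
      subst this
      simp only [Finset.mem_erase] at hb
      tauto
    · simp only [Proc.occ, ha, hc, if_false]
      apply ih
      intro b hb
      push Not at ha hc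
      simp only [Function.update_apply]
      split_ifs with h1 h2
      · subst h1; simp [Ne.symm ha.2, Ne.symm hc.2]
      · subst h2; simp [Ne.symm ha.1, Ne.symm hc.1]
      · exact H b (by simp [Proc.fn, h1, h2, hb])

/-- The hypothesis is local to `a` and `c`, with no injectivity elsewhere. It thus covers both fresh
renaming of binders and the substitution of a contraction, observed at a name that is not being
merged. If `c` is not free, it says that no free name is sent to `a`. -/
theorem occ_rename {P : Proc} (σ : Name → Name) {a c : Name} (H : ∀ b ∈ P.fn, σ b = a ↔ b = c) :
    (P.rename σ).occ a = P.occ c := by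
  induction P generalizing σ a c with
  | link y z =>
    have h1 := H y (by simp [Proc.fn])
    have h2 := H z (by simp [Proc.fn])
    simp only [Proc.rename, Proc.occ, eq_comm (a := a), eq_comm (a := c), h1, h2]
  | halt => simp [Proc.rename, Proc.occ]
  | new y y' P ih =>
    exact occ_new_update (fresh_not_mem _) (fresh_insert_not_mem _ _) ih H
  | par P Q ihP ihQ =>
    simp only [Proc.rename, Proc.occ]
    rw [ihP σ fun b hb => H b (Finset.mem_union_left _ hb),
      ihQ σ fun b hb => H b (Finset.mem_union_right _ hb)]
  | send y z P ih | recv y z P ih | client y z P ih | server y z P ih =>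
    simp only [Proc.rename, Proc.occ, fn_rename]
    rw [image_update_erase _ _ (fresh_not_mem _)]
    exact headOcc_image H
  | close y P ih | wait y P ih | inl y P ih | inr y P ih =>
    simp only [Proc.rename, Proc.occ, fn_rename]
    exact headOcc_image H
  | offer y P Q ihP ihQ =>
    simp only [Proc.rename, Proc.occ, fn_rename, ← Finset.image_union]
    exact headOcc_image H
  | offerNone y =>
    simp only [Proc.rename, Proc.occ]
    rw [← Finset.image_empty σ]
    exact headOcc_image H

theorem some_mem_headOcc {h k : Head} {y : Name} {s : Finset Name} {x : Name} :
    some k ∈ headOcc h y s x ↔ x = y ∧ k = h := by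
  unfold headOcc
  split_ifs <;> simp_all

/-- The names on which the renamed process acts are the images of those on which it acted. -/
theorem some_mem_occ_rename {P : Proc} {σ : Name → Name} {h : Head} {a : Name} :
    some h ∈ (P.rename σ).occ a ↔ ∃ c, σ c = a ∧ some h ∈ P.occ c := by
  induction P generalizing σ a with
  | link y z =>
    simp only [Proc.rename, Proc.occ]
    constructor
    · intro H
      split_ifs at H with e
      · rcases e with e | e
        · exact ⟨y, e.symm, by simpa using H⟩
        · exact ⟨z, e.symm, by simpa using H⟩
      · simp at H
    · rintro ⟨c, rfl, H⟩
      split_ifs at H with e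
      · rcases e with rfl | rfl <;> simpa using H
      · simp at H
  | halt => simp [Proc.rename, Proc.occ]
  | new y y' P ih =>
    have h1 := fresh_not_mem (((P.fn.erase y).erase y').image σ)
    have h2 := fresh_insert_not_mem (fresh (((P.fn.erase y).erase y').image σ))
      (((P.fn.erase y).erase y').image σ)
    simp only [Proc.rename, Proc.occ]
    generalize fresh (insert (fresh (((P.fn.erase y).erase y').image σ))
      (((P.fn.erase y).erase y').image σ)) = z' at *
    generalize fresh (((P.fn.erase y).erase y').image σ) = z at *
    constructor
    · intro H
      split_ifs at H with e
      · simp at H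
      · obtain ⟨c, hc, H⟩ := ih.1 H
        push Not at e
        simp only [Function.update_apply] at hc
        split_ifs at hc with e1 e2
        · exact absurd hc.symm e.2
        · exact absurd hc.symm e.1
        · exact ⟨c, hc, by simpa [e1, e2] using H⟩
    · rintro ⟨c, rfl, H⟩
      split_ifs at H with e
      · simp at H
      · push Not at e
        have hc : c ∈ P.fn := by
          by_contra hc
          rw [occ_eq_zero.2 hc] at H
          simp at H
        -- As the image of a free name of the cut, `σ c` differs from both fresh binders.
        have hi : σ c ∈ ((P.fn.erase y).erase y').image σ :=
          Finset.mem_image_of_mem _ (by simp [e, hc])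
        rw [if_neg]
        · exact ih.2 ⟨c, by simp [e], H⟩
        · rintro (e' | e') <;> rw [e'] at hi
          exacts [h1 hi, h2 hi]
  | par P Q ihP ihQ =>
    simp only [Proc.rename, Proc.occ, Multiset.mem_add, ihP, ihQ]
    constructor
    · rintro (⟨c, e, H⟩ | ⟨c, e, H⟩)
      exacts [⟨c, e, Or.inl H⟩, ⟨c, e, Or.inr H⟩]
    · rintro ⟨c, e, H | H⟩
      exacts [Or.inl ⟨c, e, H⟩, Or.inr ⟨c, e, H⟩]
  | _ =>
    simp only [Proc.rename, Proc.occ, some_mem_headOcc]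
    constructor
    · rintro ⟨rfl, rfl⟩; exact ⟨_, rfl, rfl, rfl⟩
    · rintro ⟨c, rfl, rfl, rfl⟩; exact ⟨rfl, rfl⟩

/-- The condition at a cut sees only the occurrences of its binders, and fresh binders inherit
exactly those of the old ones. -/
theorem allCuts_new_update {C : Multiset (Option Head) → Multiset (Option Head) → Prop}
    {x x' z z' : Name} {P : Proc} {σ : Name → Name} (hne : z ≠ z')
    (hz : z ∉ ((P.fn.erase x).erase x').image σ) (hz' : z' ∉ ((P.fn.erase x).erase x').image σ)
    (ih : ∀ σ : Name → Name, (P.rename σ).AllCuts C ↔ P.AllCuts C) :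
    (Proc.new z z' (P.rename (Function.update (Function.update σ x z) x' z'))).AllCuts C ↔
      (Proc.new x x' P).AllCuts C := by
  have h' : (P.rename (Function.update (Function.update σ x z) x' z')).occ z' = P.occ x' := by
    apply occ_rename
    intro b hb
    simp only [Function.update_apply]
    split_ifs with h1 h2
    · simp [h1]
    · simp [h1, hne]
    · simp only [h1, iff_false]
      exact fun e => hz' (Finset.mem_image.2 ⟨b, by simp [h1, h2, hb], e⟩)
  have h : (P.rename (Function.update (Function.update σ x z) x' z')).occ z =
      if x = x' then 0 else P.occ x := by
    split_ifs with hx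
    · rw [occ_eq_zero, fn_rename, Finset.mem_image]
      rintro ⟨b, hb, e⟩
      simp only [Function.update_apply] at e
      split_ifs at e with h1 h2
      · exact hne e.symm
      · exact h1 (h2.trans hx)
      · exact hz (Finset.mem_image.2 ⟨b, by simp [h1, h2, hb], e⟩)
    · apply occ_rename
      intro b hb
      simp only [Function.update_apply]
      split_ifs with h1 h2
      · subst h1; simp [hne.symm, Ne.symm hx]
      · simp [h2]
      · simp only [h2, iff_false]
        exact fun e => hz (Finset.mem_image.2 ⟨b, by simp [h1, h2, hb], e⟩)
  simp only [Proc.AllCuts, ih, h', h, hne, if_false]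

/-- No injectivity is needed: merging free names cannot affect the occurrences of bound endpoints,
since binders are replaced by fresh names. This handles the contraction rules. -/
theorem allCuts_rename {C : Multiset (Option Head) → Multiset (Option Head) → Prop} {P : Proc}
    (σ : Name → Name) : (P.rename σ).AllCuts C ↔ P.AllCuts C := by
  induction P generalizing σ with
  | new y y' P ih =>
    exact allCuts_new_update (fresh_fresh_ne _) (fresh_not_mem _) (fresh_insert_not_mem _ _) ih
  | par P Q ihP ihQ => simp only [Proc.rename, Proc.AllCuts, ihP, ihQ]
  | _ => simp only [Proc.rename, Proc.AllCuts]

/-! ### Invariance under structural congruence -/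

theorem AlphaAx.fn_eq {P Q : Proc} (h : AlphaAx P Q) : P.fn = Q.fn := by
  cases h with
  | new x x' z z' P hne hz hz' =>
    have e := image_update_update_erase P.fn id (x := x) (x' := x') (z := z) (z' := z')
      (by simpa [Proc.fn] using hz) (by simpa [Proc.fn] using hz')
    simp only [Proc.fn, fn_rename, e, Finset.image_id]
  | _ x y z P hz =>
    have e := image_update_erase P.fn id (y := y) (z := z) (by simpa using hz)
    simp only [Proc.fn, Proc.subst, fn_rename, e, Finset.image_id]

theorem AlphaAx.occ_eq {P Q : Proc} (h : AlphaAx P Q) (a : Name) : P.occ a = Q.occ a := by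
  cases h with
  | new x x' z z' P hne hz hz' =>
    exact (occ_new_update (by simpa [Proc.fn] using hz) (by simpa [Proc.fn] using hz')
      (fun σ => occ_rename σ) fun _ _ => Iff.rfl).symm
  | _ x y z P hz =>
    have e := image_update_erase P.fn id (y := y) (z := z) (by simpa using hz)
    simp only [Proc.occ, Proc.subst, fn_rename, e, Finset.image_id]

theorem AlphaAx.allCuts_iff {C : Multiset (Option Head) → Multiset (Option Head) → Prop}
    {P Q : Proc} (h : AlphaAx P Q) : P.AllCuts C ↔ Q.AllCuts C := by
  cases h with
  | new x x' z z' P hne hz hz' =>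
    exact (allCuts_new_update hne (by simpa [Proc.fn] using hz) (by simpa [Proc.fn] using hz')
      fun σ => allCuts_rename σ).symm
  | _ => simp only [Proc.AllCuts]

theorem StructAx.fn_eq {P Q : Proc} (h : StructAx P Q) : P.fn = Q.fn := by
  cases h with
  | alpha h => exact h.fn_eq
  | linkComm x y => simp [Proc.fn, Finset.pair_comm]
  | mixComm P Q => simp [Proc.fn, Finset.union_comm]
  | mixAssoc P Q R => simp [Proc.fn, Finset.union_assoc]
  | mixHalt => simp [Proc.fn]
  | newHalt => simp [Proc.fn]
  | newSwap => simp [Proc.fn, Finset.erase_right_comm]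
  | newComm =>
    ext a
    simp only [Proc.fn, Finset.mem_erase]
    tauto
  | scopeExt x x' P Q h h' =>
    ext a
    simp only [Proc.fn, Finset.mem_erase, Finset.mem_union]
    constructor
    · tauto
    · rintro (ha | ha)
      · exact ⟨fun e => h' (e ▸ ha), fun e => h (e ▸ ha), Or.inl ha⟩
      · tauto

theorem StructAx.occ_eq {P Q : Proc} (h : StructAx P Q) (a : Name) : P.occ a = Q.occ a := by
  cases h with
  | alpha h => exact h.occ_eq a
  | linkComm x y => simp only [Proc.occ, or_comm]
  | mixComm P Q => simp only [Proc.occ, add_comm]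
  | mixAssoc P Q R => simp only [Proc.occ, add_assoc]
  | mixHalt => simp only [Proc.occ, add_zero]
  | newHalt => simp [Proc.occ]
  | newSwap => simp only [Proc.occ, or_comm]
  | newComm => simp only [Proc.occ]; split_ifs <;> rfl
  | scopeExt x x' P Q h h' =>
    simp only [Proc.occ]
    split_ifs with e
    · have : P.occ a = 0 := by
        rw [occ_eq_zero]
        rcases e with rfl | rfl <;> assumption
      simp [this]
    · rfl

/-- `C0` serves the axiom that erases a cut around `0`, and `Cs` the swap of endpoints. Scope
extrusion is neutral because the extruded process contributes no occurrences of the endpoints. -/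
theorem StructAx.allCuts_iff {C : Multiset (Option Head) → Multiset (Option Head) → Prop}
    (C0 : C 0 0) (Cs : ∀ u v, C u v → C v u) {P Q : Proc} (h : StructAx P Q) :
    P.AllCuts C ↔ Q.AllCuts C := by
  cases h with
  | alpha h => exact h.allCuts_iff
  | linkComm x y => simp only [Proc.AllCuts]
  | mixComm P Q => simp only [Proc.AllCuts, and_comm]
  | mixAssoc P Q R => simp only [Proc.AllCuts, and_assoc]
  | mixHalt => simp only [Proc.AllCuts, and_true]
  | newHalt => simp [Proc.AllCuts, Proc.occ, C0]
  | newSwap x x' P =>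
    by_cases e : x = x'
    · rw [e]
    · have := Iff.intro (Cs (P.occ x) (P.occ x')) (Cs (P.occ x') (P.occ x))
      simp only [Proc.AllCuts, e, Ne.symm e, if_false, this]
  | newComm x x' y y' P h1 h2 h3 h4 =>
    simp only [Proc.AllCuts, Proc.occ, h1, h2, h3, h4, h1.symm, h2.symm, h3.symm, h4.symm,
      or_self, if_false]
    tauto
  | scopeExt x x' P Q h h' =>
    simp only [Proc.AllCuts, Proc.occ, occ_eq_zero.2 h, occ_eq_zero.2 h', zero_add, and_assoc]

theorem StructEq.fn_eq {P Q : Proc} (h : StructEq P Q) : P.fn = Q.fn := by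
  induction h with
  | ax h => exact h.fn_eq
  | refl => rfl
  | symm _ ih => exact ih.symm
  | trans _ _ ih1 ih2 => exact ih1.trans ih2
  | par _ _ ih1 ih2 | offer _ _ _ ih1 ih2 => simp only [Proc.fn, ih1, ih2]
  | _ => simp only [Proc.fn, *]

/-- Below a prefix only the free names of the continuation count, so there `StructEq.fn_eq`
suffices. -/
theorem StructEq.occ_eq {P Q : Proc} (h : StructEq P Q) (a : Name) : P.occ a = Q.occ a := by
  induction h with
  | ax h => exact h.occ_eq a
  | refl => rfl
  | symm _ ih => exact ih.symm
  | trans _ _ ih1 ih2 => exact ih1.trans ih2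
  | new _ _ _ ih => simp only [Proc.occ, ih]
  | par _ _ ih1 ih2 => simp only [Proc.occ, ih1, ih2]
  | offer _ h1 h2 =>
    simp only [Proc.occ, StructEq.fn_eq h1, StructEq.fn_eq h2]
  | send _ _ h | recv _ _ h | client _ _ h | server _ _ h | close _ h | wait _ h | inl _ h
  | inr _ h => simp only [Proc.occ, StructEq.fn_eq h]

theorem StructEq.allCuts_iff {C : Multiset (Option Head) → Multiset (Option Head) → Prop}
    (C0 : C 0 0) (Cs : ∀ u v, C u v → C v u) {P Q : Proc} (h : StructEq P Q) :
    P.AllCuts C ↔ Q.AllCuts C := by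
  induction h with
  | ax h => exact h.allCuts_iff C0 Cs
  | refl => rfl
  | symm _ ih => exact ih.symm
  | trans _ _ ih1 ih2 => exact ih1.trans ih2
  | new _ _ h ih => simp only [Proc.AllCuts, ih, StructEq.occ_eq h]
  | par _ _ ih1 ih2 => simp only [Proc.AllCuts, ih1, ih2]
  | _ => simp only [Proc.AllCuts]

theorem Alpha.structEq {P Q : Proc} (h : Alpha P Q) : StructEq P Q := by
  induction h with
  | ax h => exact .ax (.alpha h)
  | refl P => exact .refl P
  | symm _ ih => exact .symm ih
  | trans _ _ ih1 ih2 => exact .trans ih1 ih2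
  | new x x' _ ih => exact .new x x' ih
  | par _ _ ih1 ih2 => exact .par ih1 ih2
  | send x y _ ih => exact .send x y ih
  | recv x y _ ih => exact .recv x y ih
  | close x _ ih => exact .close x ih
  | wait x _ ih => exact .wait x ih
  | inl x _ ih => exact .inl x ih
  | inr x _ ih => exact .inr x ih
  | offer x _ _ ih1 ih2 => exact .offer x ih1 ih2
  | client x y _ ih => exact .client x y ih
  | server x y _ ih => exact .server x y ih


/-! ### Consequences of typing -/

theorem Ty.dual_dual (A : Ty) : A.dual.dual = A := by
  induction A <;> simp_all [Ty.dual]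

/-- Clients and servers: the types whose channels may be shared. -/
def Ty.IsExp : Ty → Prop
  | .bang _ _ => True
  | .quest _ _ => True
  | _ => False

theorem Ty.isExp_dual {A : Ty} : A.dual.IsExp ↔ A.IsExp := by
  cases A <;> simp [Ty.dual, Ty.IsExp]

/-- A process with head `h` may act on a name of type `A`. -/
def Head.Compat : Head → Ty → Prop
  | .link, _ => True
  | .send, .tensor _ _ => True
  | .recv, .parr _ _ => True
  | .close, .one => True
  | .wait, .bot => True
  | .inl, .plus _ _ => True
  | .inr, .plus _ _ => True
  | .offer, .amp _ _ => True
  | .offerNone, .top => True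
  | .client, .bang _ _ => True
  | .server, .quest _ _ => True
  | _, _ => False

/-- Contraction changes the index of an exponential, which compatibility ignores. -/
theorem Head.compat_bang {h : Head} {m : ℕ} (n : ℕ) {A : Ty} (H : h.Compat (.bang m A)) :
    h.Compat (.bang n A) := by
  cases h <;> exact H

theorem Head.compat_quest {h : Head} {m : ℕ} (n : ℕ) {A : Ty} (H : h.Compat (.quest m A)) :
    h.Compat (.quest n A) := by
  cases h <;> exact H

theorem HyperEnv.Distinct.type_eq {G : HyperEnv} (hG : G.Distinct) {x : Name} {A B : Ty}
    (hA : (x, A) ∈ G.join) (hB : (x, B) ∈ G.join) : A = B :=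
  congrArg Prod.snd (Multiset.inj_on_of_nodup_map hG _ hA _ hB rfl)

theorem Typed.distinct {P : Proc} {G : HyperEnv} (h : Typed P G) : G.Distinct := by
  induction h with
  | alpha _ _ ih => exact ih
  | ax x y A hxy => simp [HyperEnv.Distinct, hxy]
  | mix hD => exact hD
  | halt => simp [HyperEnv.Distinct]
  | bot _ hD => exact hD
  | top _ _ hD => exact hD
  | bangOne _ _ _ hD => exact hD
  | questOne _ _ _ hD => exact hD
  | one => simp [HyperEnv.Distinct]
  | cut x x' A _ ih | tensor x y A B _ ih | parr x y A B _ ih | plusLeft x A B _ ih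
  | plusRight x A B _ ih | amp x A B _ _ ih | contBang x x' m n A _ ih
  | contQuest x x' m n A _ ih =>
    simp [HyperEnv.Distinct, Multiset.nodup_add, Multiset.disjoint_left] at ih ⊢
    grind

/-- This makes the two sides of a mix use disjoint names. The converse fails because of the rule for
`⊤`. -/
theorem Typed.declared_of_mem_fn {P : Proc} {G : HyperEnv} (h : Typed P G) {a : Name}
    (ha : a ∈ P.fn) : ∃ A, (a, A) ∈ G.join := by
  induction h generalizing a with
  | alpha hα _ ih => exact ih (hα.structEq.fn_eq ▸ ha)
  | ax x y A hxy =>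
    simp only [Proc.fn, Finset.mem_insert, Finset.mem_singleton] at ha
    rcases ha with rfl | rfl
    · exact ⟨A, by simp⟩
    · exact ⟨A.dual, by simp⟩
  | mix hD _ _ ih1 ih2 =>
    rw [Multiset.join_add]
    rcases Finset.mem_union.1 ha with ha | ha
    · exact (ih1 ha).imp fun _ h => Multiset.mem_add.2 (Or.inl h)
    · exact (ih2 ha).imp fun _ h => Multiset.mem_add.2 (Or.inr h)
  | halt => simp [Proc.fn] at ha
  | one x _ ih =>
    simp only [Proc.fn, Finset.mem_insert] at ha
    rcases ha with rfl | ha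
    · exact ⟨.one, by simp⟩
    · simpa using ih ha
  | top => simp [Proc.fn] at ha; subst ha; exact ⟨.top, by simp⟩
  | contBang x x' m n A _ ih | contQuest x x' m n A _ ih =>
    simp only [Proc.subst, fn_rename, Finset.mem_image, Function.update_apply, id] at ha
    obtain ⟨c, hc, rfl⟩ := ha
    split_ifs with e
    · simp
    · obtain ⟨B, hB⟩ := ih hc
      by_cases hcx : c = x
      · subst hcx; simp
      · refine ⟨B, ?_⟩
        simp_all
        try tauto
  | cut x x' A _ ih =>
    simp only [Proc.fn, Finset.mem_erase] at ha
    obtain ⟨B, hB⟩ := ih ha.2.2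
    refine ⟨B, ?_⟩
    simp_all
    try tauto
  | tensor x y A B _ ih | parr x y A B _ ih | bangOne x y A _ _ ih | questOne x y A _ _ ih =>
    simp only [Proc.fn, Finset.mem_insert, Finset.mem_erase] at ha
    by_cases hx : a = x
    · subst hx; simp
    · obtain ⟨B, hB⟩ := ih (by tauto : a ∈ _)
      refine ⟨B, ?_⟩
      simp_all
  | bot x _ _ ih | plusLeft x A B _ ih | plusRight x A B _ ih =>
    simp only [Proc.fn, Finset.mem_insert] at ha
    by_cases hx : a = x
    · subst hx; simp
    · obtain ⟨B, hB⟩ := ih (by tauto : a ∈ _)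
      refine ⟨B, ?_⟩
      simp_all
  | amp x A B _ _ ih1 ih2 =>
    simp only [Proc.fn, Finset.mem_insert, Finset.mem_union] at ha
    by_cases hx : a = x
    · subst hx; simp
    · rcases ha with ha | ha | ha
      · exact absurd ha hx
      · obtain ⟨B, hB⟩ := ih1 ha
        refine ⟨B, ?_⟩
        simp_all
      · obtain ⟨B, hB⟩ := ih2 ha
        refine ⟨B, ?_⟩
        simp_all

/-! ### Occurrences respect types -/

/-- The components of a process that use a name of type `A` respect this type, and there is at
most one of them unless the name can be shared. -/
def Respects (u : Multiset (Option Head)) (A : Ty) : Prop :=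
  (∀ h, some h ∈ u → h.Compat A) ∧ (¬ A.IsExp → u.card ≤ 1)

theorem respects_zero (A : Ty) : Respects 0 A := by simp [Respects]

theorem respects_headOcc {h : Head} {y : Name} {s : Finset Name} {a : Name} {A T : Ty}
    {Γ : Env} (hD : HyperEnv.Distinct {(y, T) ::ₘ Γ})
    (ha : (a, A) ∈ Multiset.join {(y, T) ::ₘ Γ}) (hT : h.Compat T) :
    Respects (headOcc h y s a) A := by
  constructor
  · intro k hk
    obtain ⟨rfl, rfl⟩ := some_mem_headOcc.1 hk
    rwa [hD.type_eq ha (B := T) (by simp)]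
  · intro _
    unfold headOcc
    split_ifs <;> simp

/-- A prefix is a single component, a mix splits the declared names between its sides, and a cut
hides its endpoints. Only contraction can make several components share a name, and its result is
exponential, where the bound on their number is waived. -/
theorem Typed.respects {P : Proc} {G : HyperEnv} (h : Typed P G) {a : Name} {A : Ty}
    (ha : (a, A) ∈ G.join) : Respects (P.occ a) A := by
  have hD := h.distinct
  induction h generalizing a A with
  | alpha hα _ ih => rw [← hα.structEq.occ_eq]; exact ih ha hD
  | ax x y B hxy =>
    simp only [Proc.occ]
    split_ifs <;> simp [Respects, Head.Compat]
  | @mix P Q G H _ h1 h2 ih1 ih2 =>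
    simp only [Proc.occ]
    rw [Multiset.join_add] at ha
    have hdis : ∀ (b : Name) (B B' : Ty), (b, B) ∈ G.join → (b, B') ∈ H.join → False := by
      intro b B B' hB hB'
      rw [HyperEnv.Distinct, Multiset.join_add, Multiset.map_add, Multiset.nodup_add] at hD
      exact (Multiset.disjoint_left.1 hD.2.2 : b ∈ _ → b ∉ _) (Multiset.mem_map_of_mem Prod.fst hB)
        (Multiset.mem_map_of_mem Prod.fst hB')
    rcases Multiset.mem_add.1 ha with ha | ha
    · have h0 : Q.occ a = 0 := occ_eq_zero.2 fun hf =>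
        (h2.declared_of_mem_fn hf).elim fun B hB => hdis _ _ _ ha hB
      rw [h0, add_zero]
      exact ih1 ha h1.distinct
    · have h0 : P.occ a = 0 := occ_eq_zero.2 fun hf =>
        (h1.declared_of_mem_fn hf).elim fun B hB => hdis _ _ _ hB ha
      rw [h0, zero_add]
      exact ih2 ha h2.distinct
  | halt => exact respects_zero _
  | @cut x x' B P Γ Δ G h ih =>
    simp only [Proc.occ]
    split_ifs
    · exact respects_zero _
    · refine ih ?_ h.distinct
      simp only [Multiset.join_cons, Multiset.mem_add, Multiset.mem_cons] at ha ⊢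
      tauto
  | contBang x x' m n B h ih | contQuest x x' m n B h ih =>
    have hD' := h.distinct
    have hx' : a ≠ x' := by
      rintro rfl
      have hf := Multiset.mem_map_of_mem Prod.fst ha
      simp [HyperEnv.Distinct, Multiset.nodup_add, Multiset.disjoint_left] at hD' hf
      grind
    by_cases hx : a = x
    · subst hx
      obtain rfl := hD.type_eq ha (by simp; exact Or.inl rfl)
      constructor
      -- A component acting on the contracted name acted before on one of the two merged names; both
      -- had the same exponential type up to its index.
      · intro k hk
        obtain ⟨c, hc, hk'⟩ := some_mem_occ_rename.1 hk
        simp only [Function.update_apply, id] at hc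
        split_ifs at hc with e
        · subst e
          have := fun T hT => (ih (a := c) (A := T) hT hD').1 k hk'
          first
            | exact Head.compat_bang _ (this (.bang n B) (by simp))
            | exact Head.compat_quest _ (this (.quest n B) (by simp))
        · subst hc
          have := fun T hT => (ih (a := c) (A := T) hT hD').1 k hk'
          first
            | exact Head.compat_bang _ (this (.bang m B) (by simp))
            | exact Head.compat_quest _ (this (.quest m B) (by simp))
      · intro he
        exact absurd (by trivial) he
    · rw [Proc.subst, occ_rename (c := a)]
      · refine ih ?_ hD'
        simp_all
        try tauto
      · intro b _
        simp only [Function.update_apply, id]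
        split_ifs with e
        · subst e; simp [Ne.symm hx, Ne.symm hx']
        · rfl
  | one x =>
    rw [← Multiset.cons_zero] at ha hD
    exact respects_headOcc hD ha trivial
  | _ => exact respects_headOcc hD ha trivial

/-- The endpoints of a channel are used according to dual types. -/
def Matched (u v : Multiset (Option Head)) : Prop := ∃ A, Respects u A ∧ Respects v A.dual

theorem matched_zero : Matched 0 0 := ⟨.one, respects_zero _, respects_zero _⟩

theorem Matched.symm (u v : Multiset (Option Head)) : Matched u v → Matched v u := by
  rintro ⟨A, hu, hv⟩
  exact ⟨A.dual, hv, by rwa [Ty.dual_dual]⟩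

/-- The type of each cut is the witness. The resulting condition is the `≡`-invariant trace of
typing on which the search for redexes relies. -/
theorem Typed.allCuts_matched {P : Proc} {G : HyperEnv} (h : Typed P G) :
    P.AllCuts Matched := by
  induction h with
  | alpha hα _ ih => exact (hα.structEq.allCuts_iff matched_zero Matched.symm).1 ih
  | mix _ _ _ ih1 ih2 => exact ⟨ih1, ih2⟩
  | cut x x' A h ih =>
    refine ⟨ih, A, ?_, h.respects (by simp)⟩
    split_ifs
    · exact respects_zero _
    · exact h.respects (by simp)
  | contBang _ _ _ _ _ _ ih | contQuest _ _ _ _ _ _ ih => exact (allCuts_rename _).2 ih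
  | _ => trivial

/-! ### Silent channels and acting names -/

/-- No communication takes place on a channel: no link acts on its endpoints, and they are not
both acted upon. -/
def Silent (u v : Multiset (Option Head)) : Prop :=
  some .link ∉ u ∧ some .link ∉ v ∧ ¬ ((∃ h, some h ∈ u) ∧ ∃ h, some h ∈ v)

theorem silent_zero : Silent 0 0 := by simp [Silent]

theorem Silent.symm (u v : Multiset (Option Head)) : Silent u v → Silent v u := by
  unfold Silent; tauto

/-- If all the channels of a well-typed process are silent, then it acts on a name of each
environment. -/
theorem Typed.exists_acting {P : Proc} {G : HyperEnv} (h : Typed P G) (hP : P.AllCuts Silent)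
    {Γ : Env} (hΓ : Γ ∈ G) : ∃ a A h, (a, A) ∈ Γ ∧ some h ∈ P.occ a := by
  have hD := h.distinct
  induction h generalizing Γ with
  | alpha hα _ ih =>
    simp only [← hα.structEq.occ_eq]
    exact ih ((hα.structEq.allCuts_iff silent_zero Silent.symm).2 hP) hΓ hD
  | ax x y B hxy =>
    obtain rfl := Multiset.mem_singleton.1 hΓ
    exact ⟨x, B, .link, by simp, by simp [Proc.occ]⟩
  | mix _ h1 h2 ih1 ih2 =>
    simp only [Proc.occ, Multiset.mem_add] at hΓ ⊢
    rcases hΓ with hΓ | hΓ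
    · obtain ⟨a, A, h, ha, hh⟩ := ih1 hP.1 hΓ h1.distinct
      exact ⟨a, A, h, ha, Or.inl hh⟩
    · obtain ⟨a, A, h, ha, hh⟩ := ih2 hP.2 hΓ h2.distinct
      exact ⟨a, A, h, ha, Or.inr hh⟩
  | halt => simp at hΓ
  | @cut x x' B P Γ₁ Δ G h ih =>
    have hD' := h.distinct
    obtain ⟨hP, hS⟩ := hP
    -- By distinctness in the premise, no name declared in the conclusion is an endpoint of the cut,
    -- so the cut hides none of its occurrences.
    have key : ∀ a A, (a, A) ∈ ((Γ₁ + Δ) ::ₘ G).join → (Proc.new x x' P).occ a = P.occ a := by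
      intro a A ha
      have hf := Multiset.mem_map_of_mem Prod.fst ha
      have : ¬ (a = x ∨ a = x') := by
        simp [HyperEnv.Distinct, Multiset.nodup_add, Multiset.disjoint_left] at hD' hf
        grind
      simp only [Proc.occ, this, if_false]
    have hne : x ≠ x' := by
      simp [HyperEnv.Distinct, Multiset.nodup_add, Multiset.disjoint_left] at hD'
      grind
    rw [if_neg hne] at hS
    rcases Multiset.mem_cons.1 hΓ with rfl | hΓ
    -- If the acting name found in the first environment is `x`, consult the second one. Finding
    -- `x'` there contradicts silence; any other name survives in the merged environment.
    · obtain ⟨a, A, k, ha, hk⟩ := ih hP (Γ := (x, B) ::ₘ Γ₁) (by simp) hD'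
      rcases Multiset.mem_cons.1 ha with e | ha
      · obtain ⟨rfl, rfl⟩ := Prod.mk.inj e
        obtain ⟨b, A', l, hb, hl⟩ := ih hP (Γ := (x', A.dual) ::ₘ Δ) (by simp) hD'
        rcases Multiset.mem_cons.1 hb with e | hb
        · obtain ⟨rfl, rfl⟩ := Prod.mk.inj e
          exact absurd ⟨⟨k, hk⟩, l, hl⟩ hS.2.2
        · exact ⟨b, A', l, by simp [hb], by rwa [key b A' (by simp [hb])]⟩
      · exact ⟨a, A, k, by simp [ha], by rwa [key a A (by simp [ha])]⟩
    · obtain ⟨a, A, k, ha, hk⟩ := ih hP (Γ := Γ) (by simp [hΓ]) hD'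
      refine ⟨a, A, k, ha, ?_⟩
      rwa [key a A (Multiset.mem_join.2 ⟨Γ, Multiset.mem_cons_of_mem hΓ, ha⟩)]
  | @contBang x x' m n B P Γ₁ Δ G h ih =>
    have hD' := h.distinct
    have hP' := (allCuts_rename _).1 hP
    -- A process acting on `x'` acts on `x` after the substitution, and `x` is still declared.
    have key : ∀ c, some c ∈ P.occ x' → some c ∈ (P.subst x x').occ x := fun c hc =>
      some_mem_occ_rename.2 ⟨x', by simp, hc⟩
    have key' : ∀ a c, a ≠ x' → some c ∈ P.occ a → some c ∈ (P.subst x x').occ a :=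
      fun a c ha hc => some_mem_occ_rename.2 ⟨a, by simp [ha], hc⟩
    rcases Multiset.mem_cons.1 hΓ with rfl | hΓ
    · obtain ⟨a, A, k, ha, hk⟩ := ih hP' (Γ := (x, .bang m B) ::ₘ Γ₁) (by simp) hD'
      by_cases hx' : a = x'
      · subst hx'
        exact ⟨x, _, k, Multiset.mem_cons_self _ _, key k hk⟩
      rcases Multiset.mem_cons.1 ha with e | ha
      · obtain ⟨rfl, rfl⟩ := Prod.mk.inj e
        exact ⟨a, _, k, Multiset.mem_cons_self _ _, key' a k hx' hk⟩
      · exact ⟨a, A, k, by simp [ha], key' a k hx' hk⟩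
    · obtain ⟨a, A, k, ha, hk⟩ := ih hP' (Γ := Γ) (by simp [hΓ]) hD'
      refine ⟨a, A, k, ha, key' a k ?_ hk⟩
      rintro rfl
      have hf : a ∈ G.join.map Prod.fst := Multiset.mem_map_of_mem Prod.fst
        (Multiset.mem_join.2 ⟨Γ, hΓ, ha⟩)
      simp [HyperEnv.Distinct, Multiset.nodup_add, Multiset.disjoint_left] at hD' hf
      grind
  | @contQuest x x' m n B P Γ₁ G h ih =>
    have hD' := h.distinct
    have hP' := (allCuts_rename _).1 hP
    have key : ∀ c, some c ∈ P.occ x' → some c ∈ (P.subst x x').occ x := fun c hc =>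
      some_mem_occ_rename.2 ⟨x', by simp, hc⟩
    have key' : ∀ a c, a ≠ x' → some c ∈ P.occ a → some c ∈ (P.subst x x').occ a :=
      fun a c ha hc => some_mem_occ_rename.2 ⟨a, by simp [ha], hc⟩
    rcases Multiset.mem_cons.1 hΓ with rfl | hΓ
    · obtain ⟨a, A, k, ha, hk⟩ :=
        ih hP' (Γ := (x, .quest m B) ::ₘ (x', .quest n B) ::ₘ Γ₁) (by simp) hD'
      by_cases hx' : a = x'
      · subst hx'
        exact ⟨x, _, k, Multiset.mem_cons_self _ _, key k hk⟩
      rcases Multiset.mem_cons.1 ha with e | ha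
      · obtain ⟨rfl, rfl⟩ := Prod.mk.inj e
        exact ⟨a, _, k, Multiset.mem_cons_self _ _, key' a k hx' hk⟩
      · rcases Multiset.mem_cons.1 ha with e | ha
        · exact absurd (congrArg Prod.fst e) hx'
        · exact ⟨a, A, k, by simp [ha], key' a k hx' hk⟩
    · obtain ⟨a, A, k, ha, hk⟩ := ih hP' (Γ := Γ) (by simp [hΓ]) hD'
      refine ⟨a, A, k, ha, key' a k ?_ hk⟩
      rintro rfl
      have hf : a ∈ G.join.map Prod.fst := Multiset.mem_map_of_mem Prod.fst
        (Multiset.mem_join.2 ⟨Γ, hΓ, ha⟩)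
      simp [HyperEnv.Distinct, Multiset.nodup_add, Multiset.disjoint_left] at hD' hf
      grind
  | one x =>
    obtain rfl := Multiset.mem_singleton.1 hΓ
    exact ⟨x, .one, .close, by simp, some_mem_headOcc.2 ⟨rfl, rfl⟩⟩
  | _ =>
    obtain rfl := Multiset.mem_singleton.1 hΓ
    exact ⟨_, _, _, Multiset.mem_cons_self _ _, some_mem_headOcc.2 ⟨rfl, rfl⟩⟩


/-! ### Normal forms up to structural congruence -/

theorem StructEq.refl (P : Proc) : StructEq P P := CongClosure.refl P

theorem StructEq.symm {P Q : Proc} (h : StructEq P Q) : StructEq Q P := CongClosure.symm h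

theorem StructEq.trans {P Q R : Proc} (h : StructEq P Q) (h' : StructEq Q R) : StructEq P R :=
  CongClosure.trans h h'

theorem StructEq.new (x x' : Name) {P Q : Proc} (h : StructEq P Q) :
    StructEq (.new x x' P) (.new x x' Q) := CongClosure.new x x' h

theorem StructEq.par {P P' Q Q' : Proc} (h : StructEq P P') (h' : StructEq Q Q') :
    StructEq (.par P Q) (.par P' Q') := CongClosure.par h h'

theorem StructEq.parComm (P Q : Proc) : StructEq (.par P Q) (.par Q P) := .ax (.mixComm P Q)

theorem StructEq.parAssoc (P Q R : Proc) :
    StructEq (.par P (.par Q R)) (.par (.par P Q) R) := .ax (.mixAssoc P Q R)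

theorem StructEq.parHalt (P : Proc) : StructEq (.par P .halt) P := .ax (.mixHalt P)

theorem StructEq.haltPar (P : Proc) : StructEq (.par .halt P) P :=
  (parComm _ _).trans (parHalt P)

theorem StructEq.newSwap (x x' : Name) (P : Proc) : StructEq (.new x x' P) (.new x' x P) :=
  .ax (.newSwap x x' P)

theorem StructEq.parLeftComm (P Q R : Proc) :
    StructEq (.par P (.par Q R)) (.par Q (.par P R)) :=
  (parAssoc P Q R).trans (((parComm P Q).par (.refl R)).trans (parAssoc Q P R).symm)

theorem StructEq.pars_cons (P : Proc) (Ps : List Proc) :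
    StructEq (pars (P :: Ps)) (.par P (pars Ps)) := by
  cases Ps with
  | nil => exact (parHalt P).symm
  | cons => exact .refl _

theorem StructEq.pars_append (Ps Qs : List Proc) :
    StructEq (pars (Ps ++ Qs)) (.par (pars Ps) (pars Qs)) := by
  induction Ps with
  | nil => exact (haltPar _).symm
  | cons P Ps ih =>
    exact (pars_cons P _).trans (((StructEq.refl P).par ih).trans
      ((parAssoc _ _ _).trans ((pars_cons P Ps).symm.par (.refl _))))

theorem StructEq.pars_perm {Ps Qs : List Proc} (h : Ps.Perm Qs) :
    StructEq (pars Ps) (pars Qs) := by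
  induction h with
  | nil => exact .refl _
  | cons P _ ih =>
    exact (pars_cons P _).trans (((StructEq.refl P).par ih).trans (pars_cons P _).symm)
  | swap P Q Ps =>
    exact (pars_cons _ _).trans (((StructEq.refl _).par (pars_cons _ _)).trans
      ((parLeftComm _ _ _).trans (((StructEq.refl _).par (pars_cons _ _).symm).trans
        (pars_cons _ _).symm)))
  | trans _ _ ih1 ih2 => exact ih1.trans ih2

theorem StructEq.pars_replicate_halt (n : ℕ) : StructEq (pars (List.replicate n .halt)) .halt := by
  induction n with
  | zero => exact .refl _
  | succ n ih => exact (pars_cons _ _).trans ((haltPar _).trans ih)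

theorem StructEq.news (cs : List (Name × Name)) {P Q : Proc} (h : StructEq P Q) :
    StructEq (NodCap.news cs P) (NodCap.news cs Q) := by
  induction cs with
  | nil => exact h
  | cons c cs ih => exact ih.new _ _

theorem news_append (cs ds : List (Name × Name)) (P : Proc) :
    news (cs ++ ds) P = news cs (news ds P) := by
  induction cs with
  | nil => rfl
  | cons c cs ih => simp only [List.cons_append, news, ih]

theorem endpoints_cons (c : Name × Name) (cs : List (Name × Name)) :
    endpoints (c :: cs) = c.1 :: c.2 :: endpoints cs := rfl

theorem endpoints_append (cs ds : List (Name × Name)) :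
    endpoints (cs ++ ds) = endpoints cs ++ endpoints ds := List.flatMap_append

theorem mem_endpoints {a : Name} {cs : List (Name × Name)} :
    a ∈ endpoints cs ↔ ∃ c ∈ cs, a = c.1 ∨ a = c.2 := by
  simp [endpoints]

/-- A cut can be moved inside other cuts. -/
theorem StructEq.news_cons {c : Name × Name} {cs : List (Name × Name)} (P : Proc)
    (h : (endpoints (c :: cs)).Nodup) :
    StructEq (NodCap.news (c :: cs) P) (NodCap.news cs (.new c.1 c.2 P)) := by
  induction cs with
  | nil => exact .refl _
  | cons d cs ih =>
    simp only [endpoints_cons, List.nodup_cons, List.mem_cons] at h ih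
    have e : StructEq (NodCap.news (c :: d :: cs) P) (NodCap.news (d :: c :: cs) P) := by
      refine CongClosure.ax (.newComm _ _ _ _ _ ?_ ?_ ?_ ?_) <;> intro e <;> simp [e] at h
    exact e.trans ((ih (by tauto)).new _ _)

theorem StructEq.par_news {cs : List (Name × Name)} (P Q : Proc)
    (h : ∀ a ∈ endpoints cs, a ∉ P.fn) :
    StructEq (.par P (NodCap.news cs Q)) (NodCap.news cs (.par P Q)) := by
  induction cs with
  | nil => exact .refl _
  | cons c cs ih =>
    simp only [endpoints_cons, List.mem_cons] at h
    exact (StructEq.symm (.ax (.scopeExt _ _ _ _ (h _ (by simp)) (h _ (by simp))))).trans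
      ((ih fun a ha => h a (by simp [ha])).new _ _)

/-! ### Existence of normal forms -/

/-- Neither a cut nor a mix. -/
def Proc.IsPrime : Proc → Prop
  | .new _ _ _ => False
  | .par _ _ => False
  | _ => True

/-- The number of top-level cuts and mixes. -/
def Proc.size : Proc → ℕ
  | .new _ _ P => P.size + 1
  | .par P Q => P.size + Q.size + 1
  | _ => 0

/-- Normalisation renames the endpoints of a cut before recursing into its body, so its induction is
on this size, not on the structure of the term. -/
theorem size_rename (P : Proc) (σ : Name → Name) : (P.rename σ).size = P.size := by
  induction P generalizing σ with
  | new x x' P ih => simp only [Proc.rename, Proc.size, ih]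
  | par P Q ihP ihQ => simp only [Proc.rename, Proc.size, ihP, ihQ]
  | _ => rfl

/-- Every process is congruent to one that consists of cuts with distinct endpoints, which can be
chosen outside a given set, around a mix of processes that are neither cuts nor mixes. -/
theorem exists_structEq_news (P : Proc) (S : Finset Name) :
    ∃ cs Ps, StructEq P (news cs (pars Ps)) ∧ (endpoints cs).Nodup ∧
      (∀ a ∈ endpoints cs, a ∉ S) ∧ ∀ R ∈ Ps, R.IsPrime := by
  induction hn : P.size using Nat.strong_induction_on generalizing P S with
  | _ n ih =>
  have prime : ∀ R : Proc, R.IsPrime → ∃ cs Ps, StructEq R (news cs (pars Ps)) ∧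
      (endpoints cs).Nodup ∧ (∀ a ∈ endpoints cs, a ∉ S) ∧ ∀ R ∈ Ps, R.IsPrime :=
    fun R hR => ⟨[], [R], .refl _, List.nodup_nil, by simp [endpoints], by simpa using hR⟩
  cases P with
  | new x x' P =>
    let T := S ∪ (Proc.new x x' P).fn
    let z := fresh T
    let z' := fresh (insert z T)
    have hz : z ∉ T := fresh_not_mem T
    have hz' : z' ∉ T := fresh_insert_not_mem z T
    have hne : z ≠ z' := fresh_fresh_ne T
    -- The inner endpoints are chosen to avoid the new `z` and `z'` as well.
    obtain ⟨cs, Ps, e, hnd, hS, hPs⟩ := ih P.size (by simp [← hn, Proc.size])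
      (P.rename (Function.update (Function.update id x z) x' z')) (insert z (insert z' S))
      (size_rename _ _)
    simp only [T, Finset.mem_union, not_or] at hz hz'
    simp only [Finset.mem_insert, not_or] at hS
    refine ⟨(z, z') :: cs, Ps, .trans (.ax (.alpha (.new x x' z z' P hne hz.2 hz'.2)))
      (e.new z z'), ?_, ?_, hPs⟩
    · simp only [endpoints_cons, List.nodup_cons, List.mem_cons, not_or]
      exact ⟨⟨hne, fun h => (hS z h).1 rfl⟩, fun h => (hS z' h).2.1 rfl, hnd⟩
    · simp only [endpoints_cons, List.mem_cons]
      rintro a (rfl | rfl | ha)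
      exacts [hz.1, hz'.1, (hS a ha).2.2]
  | par P Q =>
    -- The endpoints from `P` avoid the free names of `Q`; those from `Q` then avoid the free names
    -- of the mix obtained from `P` and the endpoints already chosen. Both scope extrusions are
    -- therefore legitimate and all endpoints are distinct.
    obtain ⟨cs, Ps, e, hnd, hS, hPs⟩ := ih P.size (by simp only [← hn, Proc.size]; omega) P
      (S ∪ Q.fn) rfl
    obtain ⟨ds, Qs, e', hnd', hS', hQs⟩ := ih Q.size (by simp only [← hn, Proc.size]; omega) Q
      (S ∪ (pars Ps).fn ∪ (endpoints cs).toFinset) rfl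
    simp only [Finset.mem_union, List.mem_toFinset, not_or] at hS hS'
    refine ⟨cs ++ ds, Ps ++ Qs, ?_, ?_, ?_, ?_⟩
    · rw [news_append]
      refine (e.par (.refl Q)).trans ((StructEq.parComm _ _).trans
        ((StructEq.par_news _ _ fun a ha => (hS a ha).2).trans (StructEq.news cs ?_)))
      refine (StructEq.parComm _ _).trans (((StructEq.refl _).par e').trans
        ((StructEq.par_news _ _ fun a ha => (hS' a ha).1.2).trans (StructEq.news ds ?_)))
      exact (StructEq.pars_append _ _).symm
    · rw [endpoints_append]
      exact List.nodup_append'.2 ⟨hnd, hnd', fun a ha ha' => (hS' a ha').2 ha⟩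
    · simp only [endpoints_append, List.mem_append]
      rintro a (ha | ha)
      exacts [(hS a ha).1, (hS' a ha).1.1]
    · simp only [List.mem_append]
      rintro R (hR | hR)
      exacts [hPs R hR, hQs R hR]
  | _ => exact prime _ trivial

/-! ### Occurrences in normal forms -/

theorem occ_news (a : Name) (cs : List (Name × Name)) (P : Proc) :
    (news cs P).occ a = if a ∈ endpoints cs then 0 else P.occ a := by
  induction cs with
  | nil => simp [news, endpoints]
  | cons c cs ih =>
    simp only [news, Proc.occ, ih, endpoints_cons, List.mem_cons]
    split_ifs <;> first | rfl | tauto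

theorem mem_occ_pars {a : Name} {Ps : List Proc} {o : Option Head} :
    o ∈ (pars Ps).occ a ↔ ∃ R ∈ Ps, o ∈ R.occ a := by
  induction Ps with
  | nil => simp [pars, Proc.occ]
  | cons P Ps ih => simp [(StructEq.pars_cons P Ps).occ_eq, Proc.occ, ih]

theorem mem_actsOn_iff {R : Proc} (hR : R.IsPrime) {a : Name} :
    a ∈ R.actsOn ↔ ∃ h, some h ∈ R.occ a := by
  cases R with
  | link u v =>
    simp only [Proc.actsOn, Proc.occ]
    split_ifs with e <;> simp [e]
  | _ => simp_all [Proc.IsPrime, Proc.actsOn, Proc.occ, some_mem_headOcc]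

theorem eq_link_of_mem_occ {R : Proc} (hR : R.IsPrime) {a : Name}
    (h : some Head.link ∈ R.occ a) : ∃ u v, R = .link u v ∧ (a = u ∨ a = v) := by
  cases R with
  | link u v =>
    simp only [Proc.occ] at h
    split_ifs at h with e
    · exact ⟨u, v, rfl, e⟩
    · simp at h
  | halt => simp [Proc.occ] at h
  | new | par => exact hR.elim
  | _ => simp [Proc.occ, some_mem_headOcc] at h

/-- Since the endpoints are distinct, no inner cut hides an endpoint of an outer one: every
condition can be read off the mix itself. -/
theorem allCuts_news_iff {C : Multiset (Option Head) → Multiset (Option Head) → Prop}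
    {cs : List (Name × Name)} {Ps : List Proc} (hcs : (endpoints cs).Nodup)
    (hPs : ∀ R ∈ Ps, R.IsPrime) :
    (news cs (pars Ps)).AllCuts C ↔
      ∀ c ∈ cs, C ((pars Ps).occ c.1) ((pars Ps).occ c.2) := by
  have h0 : (pars Ps).AllCuts C := by
    induction Ps with
    | nil => trivial
    | cons P Ps ih =>
      have hP : P.AllCuts C := by
        have := hPs P (by simp)
        cases P <;> trivial
      cases Ps with
      | nil => exact hP
      | cons Q Ps => exact ⟨hP, ih fun R hR => hPs R (by simp [hR])⟩
  induction cs with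
  | nil => simpa [news] using h0
  | cons c cs ih =>
    simp only [endpoints_cons, List.nodup_cons, List.mem_cons, not_or] at hcs
    simp only [news, Proc.AllCuts, ih hcs.2.2, occ_news, hcs.1.1, hcs.1.2, hcs.2.1, if_false,
      List.forall_mem_cons, and_comm]

/-! ### Redexes -/

theorem Red.news (cs : List (Name × Name)) {P Q : Proc} (h : Red P Q) :
    Red (NodCap.news cs P) (NodCap.news cs Q) := by
  induction cs with
  | nil => exact h
  | cons c cs ih => exact .new _ _ ih

theorem Red.of_structEq {P Q R : Proc} (e : StructEq P Q) (h : Red Q R) : Red P R :=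
  .equiv e h (.refl R)

/-- Some reduction applies to `P`. -/
def Reduces (P : Proc) : Prop := ∃ Q, Red P Q

theorem Reduces.of_structEq {P Q : Proc} (e : StructEq P Q) : Reduces Q → Reduces P :=
  fun ⟨R, h⟩ => ⟨R, h.of_structEq e⟩

theorem reduces_link {x x' u v : Name} {R : Proc} (h : x = u ∨ x = v) :
    Reduces (.new x x' (.par (.link u v) R)) := by
  rcases h with rfl | rfl
  · exact ⟨_, .of_structEq ((StructEq.par (.ax (.linkComm _ _)) (.refl R)).new _ _)
      (.link _ _ _ _)⟩
  · exact ⟨_, .link _ _ _ _⟩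

theorem exists_fresh_pair (S : Finset Name) : ∃ z z', z ≠ z' ∧ z ∉ S ∧ z' ∉ S :=
  ⟨_, _, fresh_fresh_ne S, fresh_not_mem S, fresh_insert_not_mem _ S⟩

/-- Both bound names are first α-renamed to a fresh distinct pair, which meets the side conditions
of the reduction rule. -/
theorem reduces_send_recv (x x' y y' : Name) (P Q : Proc) :
    Reduces (.new x x' (.par (.send x y P) (.recv x' y' Q))) := by
  obtain ⟨z, z', hne, hz, hz'⟩ := exists_fresh_pair (P.fn ∪ Q.fn ∪ {y, y'})
  simp only [Finset.mem_union, Finset.mem_insert, Finset.mem_singleton, not_or] at hz hz'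
  refine .of_structEq ((StructEq.par
    (.ax (.alpha (.send x y z P fun h => hz.1.1 (Finset.mem_of_mem_erase h))))
    (.ax (.alpha (.recv x' y' z' Q fun h => hz'.1.2 (Finset.mem_of_mem_erase h))))).new _ _)
    ⟨_, .tensorParr x x' z z' _ _ hne ?_ ?_⟩
  · simp only [Proc.subst, fn_rename, Finset.mem_image, Function.update_apply, id]
    rintro ⟨b, hb, e⟩
    split_ifs at e with h
    exacts [hne e.symm, hz.1.2 (e ▸ hb)]
  · simp only [Proc.subst, fn_rename, Finset.mem_image, Function.update_apply, id]
    rintro ⟨b, hb, e⟩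
    split_ifs at e with h
    exacts [hne e, hz'.1.1 (e ▸ hb)]

theorem reduces_client_server (x x' y y' : Name) (P Q R : Proc) :
    Reduces (.new x x' (.par (.par (.client x y P) (.server x' y' Q)) R)) := by
  obtain ⟨z, z', hne, hz, hz'⟩ := exists_fresh_pair (P.fn ∪ Q.fn ∪ {y, y'})
  simp only [Finset.mem_union, Finset.mem_insert, Finset.mem_singleton, not_or] at hz hz'
  refine .of_structEq (((StructEq.par
    (.ax (.alpha (.client x y z P fun h => hz.1.1 (Finset.mem_of_mem_erase h))))
    (.ax (.alpha (.server x' y' z' Q fun h => hz'.1.2 (Finset.mem_of_mem_erase h))))).par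
    (.refl R)).new _ _) ⟨_, .star x x' z z' _ _ R hne ?_ ?_⟩
  · simp only [Proc.subst, fn_rename, Finset.mem_image, Function.update_apply, id]
    rintro ⟨b, hb, e⟩
    split_ifs at e with h
    exacts [hne e.symm, hz.1.2 (e ▸ hb)]
  · simp only [Proc.subst, fn_rename, Finset.mem_image, Function.update_apply, id]
    rintro ⟨b, hb, e⟩
    split_ifs at e with h
    exacts [hne e, hz'.1.1 (e ▸ hb)]

/-- The part of a mix that does not use a channel can be taken out of its scope. -/
theorem Reduces.new_par_par {x x' : Name} {P Q R : Proc} (hx : x ∉ R.fn) (hx' : x' ∉ R.fn) :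
    Reduces (.new x x' (.par P Q)) → Reduces (.new x x' (.par P (.par Q R))) := by
  rintro ⟨S, h⟩
  refine .of_structEq (((StructEq.parAssoc P Q R).trans (StructEq.parComm _ _)).new _ _)
    (.of_structEq (.ax (.scopeExt _ _ _ _ hx hx')) (.of_structEq (StructEq.parComm _ _)
      ⟨_, .mix R h⟩))

theorem reduces_of_pos {x x' : Name} {P Q R : Proc} {A : Ty}
    (hA : A = .one ∨ (∃ B C, A = .tensor B C) ∨ (∃ B C, A = .plus B C) ∨ A = .zero ∨
      ∃ n B, A = .bang n B)
    (hP : P.IsPrime) (hQ : Q.IsPrime) {h h' : Head} (hh : some h ∈ P.occ x)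
    (hh' : some h' ∈ Q.occ x') (hl : h ≠ .link) (hl' : h' ≠ .link) (hc : h.Compat A)
    (hc' : h'.Compat A.dual) (hR : ¬ A.IsExp → x ∉ R.fn ∧ x' ∉ R.fn) :
    Reduces (.new x x' (.par P (.par Q R))) := by
  have hocc : ∀ (P : Proc) (x : Name) (k : Head), P.IsPrime → some k ∈ P.occ x → k ≠ .link →
    match k with
    | .link => True
    | .send => ∃ y S, P = .send x y S
    | .recv => ∃ y S, P = .recv x y S
    | .close => ∃ S, P = .close x S
    | .wait => ∃ S, P = .wait x S
    | .inl => ∃ S, P = .inl x S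
    | .inr => ∃ S, P = .inr x S
    | .offer => ∃ S T, P = .offer x S T
    | .offerNone => P = .offerNone x
    | .client => ∃ y S, P = .client x y S
    | .server => ∃ y S, P = .server x y S := by
    intro P x k hP hk hne
    cases P with
    | link u v =>
      simp only [Proc.occ] at hk
      split_ifs at hk <;> simp_all
    | halt => simp [Proc.occ] at hk
    | new | par => exact hP.elim
    | _ =>
      obtain ⟨rfl, rfl⟩ := some_mem_headOcc.1 hk
      simp
  have h1 := hocc P x h hP hh hl
  have h2 := hocc Q x' h' hQ hh' hl'
  rcases hA with rfl | ⟨B, C, rfl⟩ | ⟨B, C, rfl⟩ | rfl | ⟨n, B, rfl⟩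
  · cases h <;> first | exact hc.elim | exact absurd rfl hl | skip
    cases h' <;> first | exact hc'.elim | exact absurd rfl hl' | skip
    obtain ⟨S, rfl⟩ := h1
    obtain ⟨T, rfl⟩ := h2
    obtain ⟨hx, hx'⟩ := hR (by simp [Ty.IsExp])
    exact .new_par_par hx hx' ⟨_, .oneBot _ _ _ _⟩
  · cases h <;> first | exact hc.elim | exact absurd rfl hl | skip
    cases h' <;> first | exact hc'.elim | exact absurd rfl hl' | skip
    obtain ⟨y, S, rfl⟩ := h1
    obtain ⟨y', T, rfl⟩ := h2
    obtain ⟨hx, hx'⟩ := hR (by simp [Ty.IsExp])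
    exact .new_par_par hx hx' (reduces_send_recv _ _ _ _ _ _)
  · obtain ⟨hx, hx'⟩ := hR (by simp [Ty.IsExp])
    cases h <;> first | exact hc.elim | exact absurd rfl hl | skip
    all_goals
      cases h' <;> first | exact hc'.elim | exact absurd rfl hl' | skip
      obtain ⟨S, rfl⟩ := h1
      obtain ⟨T, U, rfl⟩ := h2
    · exact .new_par_par hx hx' ⟨_, .plusAmpLeft _ _ _ _ _⟩
    · exact .new_par_par hx hx' ⟨_, .plusAmpRight _ _ _ _ _⟩
  -- Only a link can act on a name of type `0`.
  · cases h <;> first | exact hc.elim | exact absurd rfl hl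
  · cases h <;> first | exact hc.elim | exact absurd rfl hl | skip
    cases h' <;> first | exact hc'.elim | exact absurd rfl hl' | skip
    obtain ⟨y, S, rfl⟩ := h1
    obtain ⟨y', T, rfl⟩ := h2
    exact .of_structEq ((StructEq.parAssoc _ _ _).new _ _) (reduces_client_server _ _ _ _ _ _ _)

/-- Two processes that act on the endpoints of a matched channel, and are not links, form a
redex. -/
theorem reduces_of_matched {x x' : Name} {P Q R : Proc} (hP : P.IsPrime) (hQ : Q.IsPrime)
    {h h' : Head} (hh : some h ∈ P.occ x)
    (hh' : some h' ∈ Q.occ x') (hl : h ≠ .link) (hl' : h' ≠ .link)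
    (hm : Matched ((Proc.par P (.par Q R)).occ x) ((Proc.par P (.par Q R)).occ x')) :
    Reduces (.new x x' (.par P (.par Q R))) := by
  obtain ⟨A, ⟨hc, hu⟩, hc', hv⟩ := hm
  have hcP := hc h (by simp [Proc.occ, hh])
  have hcQ := hc' h' (by simp [Proc.occ, hh'])
  have hR : ¬ A.IsExp → x ∉ R.fn ∧ x' ∉ R.fn := by
    intro hA
    have h1 := hu hA
    have h2 := hv (by rwa [Ty.isExp_dual])
    -- At a linear type, `P` and `Q` exhaust the single occurrence allowed for `x` and `x'`
    -- respectively, leaving none for `R`.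
    have h3 := Multiset.card_pos_iff_exists_mem.2 ⟨_, hh⟩
    have h4 := Multiset.card_pos_iff_exists_mem.2 ⟨_, hh'⟩
    simp only [Proc.occ, Multiset.card_add] at h1 h2
    exact ⟨occ_eq_zero.1 (Multiset.card_eq_zero.1 (by omega)),
      occ_eq_zero.1 (Multiset.card_eq_zero.1 (by omega))⟩
  have swap : Reduces (.new x' x (.par Q (.par P R))) →
      Reduces (.new x x' (.par P (.par Q R))) :=
    .of_structEq ((StructEq.newSwap _ _ _).trans ((StructEq.parLeftComm _ _ _).new _ _))
  cases A with
  | tensor | one | plus | zero | bang =>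
    exact reduces_of_pos (by simp) hP hQ hh hh' hl hl' hcP hcQ hR
  | _ =>
    refine swap (reduces_of_pos (by simp [Ty.dual]) hQ hP hh' hh hl' hl hcQ
      (by rwa [Ty.dual_dual]) ?_)
    rw [Ty.isExp_dual]
    exact fun h => (hR h).symm

/-! ### Progress -/

theorem link_of_two_mem_actsOn {R : Proc} {a b : Name} (hne : a ≠ b) (ha : a ∈ R.actsOn)
    (hb : b ∈ R.actsOn) : ∃ u v, R = .link u v := by
  cases R with
  | link u v => exact ⟨u, v, rfl⟩
  | _ => simp_all [Proc.actsOn]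

/-- Indices are used because equal processes may occur at different positions of the mix. -/
theorem exists_perm_cons_cons {α : Type*} (l : List α) {i j : Fin l.length} (hij : i ≠ j) :
    ∃ l', l.Perm (l.get i :: l.get j :: l') := by
  induction l with
  | nil => exact i.elim0
  | cons a l ih =>
    have mem : ∀ k : Fin l.length, ∃ l', l.Perm (l.get k :: l') := fun k => by
      obtain ⟨s, t, e⟩ := List.append_of_mem (List.get_mem l k)
      exact ⟨s ++ t, (List.Perm.of_eq e).trans List.perm_middle⟩
    induction i using Fin.cases with
    | zero =>
      induction j using Fin.cases with
      | zero => exact absurd rfl hij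
      | succ j =>
        obtain ⟨l', h⟩ := mem j
        exact ⟨l', h.cons a⟩
    | succ i =>
      induction j using Fin.cases with
      | zero =>
        obtain ⟨l', h⟩ := mem i
        exact ⟨l', (h.cons a).trans (List.Perm.swap _ _ _)⟩
      | succ j =>
        obtain ⟨l', h⟩ := ih (i := i) (j := j) fun e => hij (by rw [e])
        exact ⟨a :: l', (h.cons a).trans ((List.Perm.swap _ _ _).trans
          ((List.Perm.swap _ _ _).cons _))⟩

/-- A cut of a normal form can be brought next to the mix. -/
theorem Reduces.news_of_mem {cs : List (Name × Name)} {c : Name × Name} {P : Proc}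
    (hcs : (endpoints cs).Nodup) (hc : c ∈ cs) :
    Reduces (.new c.1 c.2 P) → Reduces (news cs P) := by
  obtain ⟨s, t, rfl⟩ := List.append_of_mem hc
  rw [endpoints_append] at hcs
  rintro ⟨Q, h⟩
  rw [news_append]
  exact .of_structEq (StructEq.news s (StructEq.news_cons P (List.nodup_append'.1 hcs).2.1))
    ⟨_, (h.news t).news s⟩

theorem endpoints_fst_ne_snd {cs : List (Name × Name)} (hcs : (endpoints cs).Nodup)
    {c : Name × Name} (hc : c ∈ cs) : c.1 ≠ c.2 := by
  obtain ⟨s, t, rfl⟩ := List.append_of_mem hc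
  rw [endpoints_append] at hcs
  have := (List.nodup_append'.1 hcs).2.1
  simp only [endpoints_cons, List.nodup_cons, List.mem_cons, not_or] at this
  exact this.1.1

/-- The link rule accepts any process as the rest of the cut, so no typing information is needed. -/
theorem reduces_news_of_link {cs : List (Name × Name)} {Ps : List Proc}
    (hcs : (endpoints cs).Nodup) {u v : Name} (hl : Proc.link u v ∈ Ps)
    (h : u ∈ endpoints cs ∨ v ∈ endpoints cs) : Reduces (news cs (pars Ps)) := by
  obtain ⟨a, ha, hac⟩ : ∃ a ∈ endpoints cs, a = u ∨ a = v := by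
    rcases h with h | h
    exacts [⟨u, h, Or.inl rfl⟩, ⟨v, h, Or.inr rfl⟩]
  obtain ⟨c, hc, e⟩ := mem_endpoints.1 ha
  obtain ⟨s, t, rfl⟩ := List.append_of_mem hl
  have e' : StructEq (pars (s ++ .link u v :: t)) (.par (.link u v) (pars (s ++ t))) :=
    (StructEq.pars_perm List.perm_middle).trans (StructEq.pars_cons _ _)
  refine Reduces.news_of_mem hcs hc (.of_structEq (e'.new _ _) ?_)
  rcases e with rfl | rfl
  · exact reduces_link hac
  · exact .of_structEq (StructEq.newSwap _ _ _) (reduces_link hac)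

/-- A normal form all of whose channels are matched is canonical or has a redex. -/
theorem canonical_or_reduces {cs : List (Name × Name)} {Ps : List Proc}
    (hcs : (endpoints cs).Nodup) (hPs : ∀ R ∈ Ps, R.IsPrime)
    (hm : ∀ c ∈ cs, Matched ((pars Ps).occ c.1) ((pars Ps).occ c.2)) :
    IsCanonical (news cs (pars Ps)) ∨ Reduces (news cs (pars Ps)) := by
  by_cases hr : Reduces (news cs (pars Ps))
  · exact Or.inr hr
  left
  have hlink : ∀ u v, Proc.link u v ∈ Ps → u ∉ endpoints cs ∧ v ∉ endpoints cs := by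
    intro u v hl
    by_contra h
    exact hr (reduces_news_of_link hcs hl (by tauto))
  have hmem : ∀ {R : Proc}, R ∈ Ps ++ List.replicate (cs.length + 1) .halt →
      R ∈ Ps ∨ R = .halt := fun h =>
    (List.mem_append.1 h).imp_right List.eq_of_mem_replicate
  -- A canonical form must have more processes than channels. Padding with `n + 1` copies of `0`,
  -- which act on nothing, ensures this with `m = Ps.length`.
  refine ⟨cs, Ps ++ List.replicate (cs.length + 1) .halt, ?_, hcs, ⟨Ps.length, ?_⟩, ?_, ?_, ?_, ?_⟩
  · exact StructEq.news cs ((StructEq.parHalt _).symm.trans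
      (((StructEq.refl _).par (StructEq.pars_replicate_halt _).symm).trans
        (StructEq.pars_append _ _).symm))
  · simp only [List.length_append, List.length_replicate]
    omega
  · rintro R hR x x' Q rfl
    rcases hmem hR with h | h
    exacts [hPs _ h, nomatch h]
  · rintro R hR Q Q' rfl
    rcases hmem hR with h | h
    exacts [hPs _ h, nomatch h]
  · intro u v hR
    rcases hmem hR with h | h
    exacts [hlink u v h, nomatch h]
  · rintro c hc i j hij ⟨hi, hj⟩
    obtain ⟨l, hl⟩ := exists_perm_cons_cons _ hij
    have hmi := hmem (List.get_mem _ i)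
    have hmj := hmem (List.get_mem _ j)
    generalize (Ps ++ List.replicate (cs.length + 1) Proc.halt).get i = P at *
    generalize (Ps ++ List.replicate (cs.length + 1) Proc.halt).get j = Q at *
    replace hmi : P ∈ Ps := hmi.resolve_right fun e => by simp [e, Proc.actsOn] at hi
    replace hmj : Q ∈ Ps := hmj.resolve_right fun e => by simp [e, Proc.actsOn] at hj
    obtain ⟨h, hh⟩ := (mem_actsOn_iff (hPs _ hmi)).1 hi
    obtain ⟨h', hh'⟩ := (mem_actsOn_iff (hPs _ hmj)).1 hj
    have e : StructEq (pars Ps) (.par P (.par Q (pars l))) :=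
      (StructEq.parHalt _).symm.trans
        (((StructEq.refl _).par (StructEq.pars_replicate_halt (cs.length + 1)).symm).trans
        ((StructEq.pars_append _ _).symm.trans ((StructEq.pars_perm hl).trans
          ((StructEq.pars_cons _ _).trans ((StructEq.refl _).par (StructEq.pars_cons _ _))))))
    have notlink : ∀ {R : Proc} {a : Name} {k : Head}, R ∈ Ps → a ∈ endpoints cs →
        some k ∈ R.occ a → k ≠ .link := by
      rintro R a _ hR ha hk rfl
      obtain ⟨u, v, rfl, rfl | rfl⟩ := eq_link_of_mem_occ (hPs R hR) hk
      exacts [(hlink _ _ hR).1 ha, (hlink _ _ hR).2 ha]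
    refine hr (Reduces.news_of_mem hcs hc (.of_structEq (e.new _ _)
      (reduces_of_matched (hPs _ hmi) (hPs _ hmj) hh hh'
        (notlink hmi (mem_endpoints.2 ⟨c, hc, Or.inl rfl⟩) hh)
        (notlink hmj (mem_endpoints.2 ⟨c, hc, Or.inr rfl⟩) hh') ?_)))
    rw [← e.occ_eq, ← e.occ_eq]
    exact hm c hc

theorem IsCanonical.of_structEq {P Q : Proc} (e : StructEq P Q) :
    IsCanonical Q → IsCanonical P := fun ⟨cs, Ps, h⟩ =>
  ⟨cs, Ps, { h with equiv := e.trans h.equiv }⟩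

theorem IsCanonicalFormOf.isPrime {cs : List (Name × Name)} {Ps : List Proc} {P : Proc}
    (h : IsCanonicalFormOf cs Ps P) {R : Proc} (hR : R ∈ Ps) : R.IsPrime := by
  cases R with
  | new x x' Q => exact h.not_new _ hR _ _ _ rfl
  | par Q Q' => exact h.not_par _ hR _ _ rfl
  | _ => trivial

theorem IsCanonicalFormOf.silent {cs : List (Name × Name)} {Ps : List Proc} {P : Proc}
    (h : IsCanonicalFormOf cs Ps P) : P.AllCuts Silent := by
  rw [h.equiv.allCuts_iff silent_zero Silent.symm,
    allCuts_news_iff h.nodup fun R => h.isPrime]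
  intro c hc
  have hl : ∀ a ∈ endpoints cs, some Head.link ∉ (pars Ps).occ a := by
    intro a ha hk
    obtain ⟨R, hR, hk⟩ := mem_occ_pars.1 hk
    obtain ⟨u, v, rfl, rfl | rfl⟩ := eq_link_of_mem_occ (h.isPrime hR) hk
    exacts [(h.not_link _ _ hR).1 ha, (h.not_link _ _ hR).2 ha]
  have h1 : c.1 ∈ endpoints cs := mem_endpoints.2 ⟨c, hc, Or.inl rfl⟩
  refine ⟨hl _ h1, hl _ (mem_endpoints.2 ⟨c, hc, Or.inr rfl⟩), ?_⟩
  rintro ⟨⟨k, hk⟩, k', hk'⟩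
  obtain ⟨R, hR, hk⟩ := mem_occ_pars.1 hk
  obtain ⟨R', hR', hk'⟩ := mem_occ_pars.1 hk'
  have ha := (mem_actsOn_iff (h.isPrime hR)).2 ⟨k, hk⟩
  have ha' := (mem_actsOn_iff (h.isPrime hR')).2 ⟨k', hk'⟩
  obtain ⟨i, rfl⟩ := List.mem_iff_get.1 hR
  obtain ⟨j, rfl⟩ := List.mem_iff_get.1 hR'
  -- The canonical-form condition concerns distinct positions only. A single process acting on both
  -- endpoints would be a link on a bound endpoint, which is excluded separately.
  by_cases hij : i = j
  · subst hij
    obtain ⟨u, v, e⟩ := link_of_two_mem_actsOn (endpoints_fst_ne_snd h.nodup hc) ha ha'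
    rw [e] at ha hR
    obtain ⟨hu, hv⟩ := h.not_link u v hR
    rcases ha with e | e
    exacts [hu (e ▸ h1), hv (Set.mem_singleton_iff.1 e ▸ h1)]
  · exact h.not_dual c hc i j hij ⟨ha, ha'⟩

end NodCap

/-- Progress: a well-typed process is in canonical form or reduces. Moreover, unless the
hyper-environment is empty, every canonical form of a well-typed process contains a process
that acts on a free name. -/
theorem mainTheorem2 (P : NodCap.Proc) (G : NodCap.HyperEnv) (hP : NodCap.Typed P G) :
    (NodCap.IsCanonical P ∨ ∃ Q, NodCap.Red P Q) ∧
    (G ≠ 0 → ∀ (cs : List (NodCap.Name × NodCap.Name)) (Ps : List NodCap.Proc),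
      NodCap.IsCanonicalFormOf cs Ps P →
        ∃ R ∈ Ps, ∃ a ∈ R.actsOn, a ∉ NodCap.endpoints cs) := by
  constructor
  · obtain ⟨cs, Ps, e, hcs, -, hPs⟩ := NodCap.exists_structEq_news P ∅
    have hm := (e.allCuts_iff NodCap.matched_zero NodCap.Matched.symm).1 hP.allCuts_matched
    rw [NodCap.allCuts_news_iff hcs hPs] at hm
    exact (NodCap.canonical_or_reduces hcs hPs hm).imp (NodCap.IsCanonical.of_structEq e)
      (NodCap.Reduces.of_structEq e)
  · intro hG cs Ps hc
    obtain ⟨Γ, hΓ⟩ := Multiset.exists_mem_of_ne_zero hG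
    obtain ⟨a, A, h, -, hh⟩ := hP.exists_acting hc.silent hΓ
    -- The occurrence in `P` is carried to the given canonical form, where bound endpoints have
    -- none; the acting name is therefore free.
    rw [hc.equiv.occ_eq, NodCap.occ_news] at hh
    split_ifs at hh with ha
    · simp at hh
    · obtain ⟨R, hR, hh⟩ := NodCap.mem_occ_pars.1 hh
      exact ⟨R, hR, a, (NodCap.mem_actsOn_iff (hc.isPrime hR)).2 ⟨h, hh⟩, ha⟩
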